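/- Let $h$ be a natural number such that $2h+1$ is a prime different from $3$, let $q=2^{2h+1}$, and let $\mathrm{Tr}$ be the absolute trace $\mathrm{GF}(q)\to\mathrm{GF}(2)$. For $\alpha,\lambda\in\mathrm{GF}(q)$ let $F_{\alpha,\lambda}$ be the set of points $(x,y,z)$ of $\mathrm{PG}(2,q)$ with $\alpha x^2+xy+y^2+\lambda z^2=0$. A collineation is an element of $\mathrm{P\Gamma L}(3,q)$. A degree-$4$ Denniston maximal arc is the image, under a collineation $g$, of a set $$\mathcal K_{\alpha,A}=\{(0,0,1)\}\cup\bigcup_{\lambda\in A\setminus\{0\}}F_{\alpha,\lambda},$$ where $\mathrm{Tr}(\alpha)=1$ and $A$ is an additive subgroup of $\mathrm{GF}(q)$ of order $4$; its conics are the three sets $g(F_{\alpha,\lambda})$, $\lambda\in A\setminus\{0\}$, its nucleus is $g(0,0,1)$, and its line at infinity $L$ is the image under $g$ of the line $z=0$. Two arcs are isomorphic if some collineation maps one onto the other, and the automorphism group of an arc is its stabiliser in $\mathrm{P\Gamma L}(3,q)$. Then: 1. The number of isomorphism classes of degree-$4$ Denniston maximal arcs in $\mathrm{PG}(2,q)$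 is $$N=\frac{2^{2h}-1}{3(2h+1)}.$$ 2. The automorphism group $G$ of every such arc has order $2(q+1)$ and is isomorphic to a semidirect product $C_{q+1}\rtimes C_2$. 3. $G$ has a cyclic subgroup of order $q+1$ that stabilises each of the three conics of the arc and acts sharply transitively on the points of each of them, and that stabilises $L$ and acts sharply transitively on the points of $L$. 4. $G$ contains exactly $q+1$ involutions. They are exactly the (non-identity) elations that stabilise each of the three conics of the arc, whose axis is a line through the nucleus and whose center is the intersection of that axis with $L$; each line through the nucleus is the axis of exactly one of them. -/

import Mathlib

open scoped LinearAlgebra.Projectivization Pointwise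

/-- The points of the Desarguesian projective plane over `K`. -/
abbrev PG2 (K : Type*) [Field K] : Type _ := ℙ K (Fin 3 → K)

namespace PG2

variable {K : Type*} [Field K]

/-- The line with coordinates `[u, v, w]`: all points `(x, y, z)` with `u x + v y + w z = 0`. -/
def line (a : PG2 K) : Set (PG2 K) := {P | a.orthogonal P}

/-- A set of points is a line. -/
def IsLine (l : Set (PG2 K)) : Prop := ∃ a : PG2 K, l = line a

/-- The point `(0, 0, 1)`. -/
def origin : PG2 K := Projectivization.mk K ![0, 0, 1] (fun h => one_ne_zero (congrFun h 2))

/-- The line at infinity `z = 0` of the standard pencil. -/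
def lineAtInfinity : Set (PG2 K) := {P | P.rep 2 = 0}

/-- The point set `F_{α,β,c}`: all points `(x, y, z)` with `α x² + x y + β y² + c z² = 0`
(the equation is homogeneous, so the choice of the representative is immaterial). -/
def conic (α β c : K) : Set (PG2 K) :=
  {P | α * P.rep 0 ^ 2 + P.rep 0 * P.rep 1 + β * P.rep 1 ^ 2 + c * P.rep 2 ^ 2 = 0}

/-- The permutation `g` of the points is induced by the semilinear map `v ↦ M (v ^ σ)`. -/
def Induces (M : GL (Fin 3) K) (σ : K ≃+* K) (g : Equiv.Perm (PG2 K)) : Prop :=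
  ∀ (v : Fin 3 → K) (hv : v ≠ 0),
    ∃ hw : M.val.mulVec (fun i => σ (v i)) ≠ 0,
      g (Projectivization.mk K v hv) = Projectivization.mk K (M.val.mulVec fun i => σ (v i)) hw

theorem mulVec_map_ne_zero (M : GL (Fin 3) K) (σ : K ≃+* K) {v : Fin 3 → K} (hv : v ≠ 0) :
    M.val.mulVec (fun i => σ (v i)) ≠ 0 := by
  intro h
  apply hv
  have h2 : (M⁻¹).val.mulVec (M.val.mulVec (fun i => σ (v i))) = 0 := by rw [h, Matrix.mulVec_zero]
  rw [Matrix.mulVec_mulVec, ← Units.val_mul, inv_mul_cancel, Units.val_one,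
    Matrix.one_mulVec] at h2
  funext i
  have := congrFun h2 i
  simpa using this

theorem map_mulVec_eq (M : Matrix (Fin 3) (Fin 3) K) (σ : K ≃+* K) (v : Fin 3 → K) :
    (fun i => σ (M.mulVec v i)) = (M.map σ).mulVec (fun i => σ (v i)) := by
  funext i
  simp [Matrix.mulVec, dotProduct, map_sum, map_mul]

/-- The collineation group `PΓL(3, K)` of the plane: the permutations of the points that are
induced by an invertible matrix together with a field automorphism. -/
def collineationGroup (K : Type*) [Field K] : Subgroup (Equiv.Perm (PG2 K)) where
  carrier := {g | ∃ (M : GL (Fin 3) K) (σ : K ≃+* K), Induces M σ g}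
  one_mem' := ⟨1, RingEquiv.refl K, fun v hv => by simpa using hv⟩
  mul_mem' := by
    rintro f g ⟨M, σ, hf⟩ ⟨N, τ, hg⟩
    refine ⟨M * Matrix.GeneralLinearGroup.map σ.toRingHom N, τ.trans σ, fun v hv => ?_⟩
    refine ⟨mulVec_map_ne_zero _ _ hv, ?_⟩
    obtain ⟨h1, e1⟩ := hg v hv
    obtain ⟨h2, e2⟩ := hf _ h1
    rw [Equiv.Perm.mul_apply, e1, e2]
    congr 1
    rw [map_mulVec_eq, Matrix.mulVec_mulVec]
    rfl
  inv_mem' := by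
    rintro g ⟨M, σ, hg⟩
    refine ⟨Matrix.GeneralLinearGroup.map σ.symm.toRingHom M⁻¹, σ.symm, fun v hv => ?_⟩
    refine ⟨mulVec_map_ne_zero _ _ hv, ?_⟩
    obtain ⟨h1, e1⟩ := hg _ (mulVec_map_ne_zero
      (Matrix.GeneralLinearGroup.map σ.symm.toRingHom M⁻¹) σ.symm hv)
    rw [Equiv.Perm.inv_eq_iff_eq, e1]
    congr 1
    have : (fun i => σ ((Matrix.GeneralLinearGroup.map σ.symm.toRingHom M⁻¹).val.mulVec
        (fun i => σ.symm (v i)) i)) = (M⁻¹).val.mulVec v := by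
      rw [map_mulVec_eq]
      congr 1
      · ext i j
        simp [Matrix.GeneralLinearGroup.map]
      · funext i
        simp
    rw [this, Matrix.mulVec_mulVec, ← Units.val_mul, mul_inv_cancel, Units.val_one,
      Matrix.one_mulVec]

/-- The automorphism group of a point set: its stabiliser in the collineation group. -/
def autGroup (D : Set (PG2 K)) : Subgroup (Equiv.Perm (PG2 K)) :=
  collineationGroup K ⊓ MulAction.stabilizer (Equiv.Perm (PG2 K)) D

/-- `e` is a (non-identity) elation with center `c` and axis `l`: a collineation that fixes all
points of the line `l` and stabilises all lines through the point `c` of `l`. -/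
structure IsElation (e : Equiv.Perm (PG2 K)) (c : PG2 K) (l : Set (PG2 K)) : Prop where
  mem_collineationGroup : e ∈ collineationGroup K
  ne_one : e ≠ 1
  isLine : IsLine l
  center_mem : c ∈ l
  fix_axis : ∀ P ∈ l, e P = P
  fix_center : ∀ m : Set (PG2 K), IsLine m → c ∈ m → e • m = m

/-- The conics of the standard pencil with parameter in `A \ {0}`, together with their
nucleus. -/
def dennistonSet (α : K) (A : AddSubgroup K) : Set (PG2 K) :=
  {origin} ∪ ⋃ c ∈ {c : K | c ∈ A ∧ c ≠ 0}, conic α 1 c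

/-- `D` is, in suitable coordinates, the degree `d` maximal arc that Denniston's construction
attaches to an `α` of absolute trace `1` and an additive subgroup `A` of order `d`. -/
def IsDennistonArc [Algebra (ZMod 2) K] (d : ℕ) (D : Set (PG2 K)) : Prop :=
  ∃ (α : K) (A : AddSubgroup K) (g : Equiv.Perm (PG2 K)),
    Algebra.trace (ZMod 2) K α = 1 ∧ Nat.card A = d ∧ g ∈ collineationGroup K ∧
      D = g • dennistonSet α A

/-- Two Denniston arcs of degree `d` are isomorphic if a collineation maps one to the other. -/
def dennistonSetoid (K : Type*) [Field K] [Algebra (ZMod 2) K] (d : ℕ) :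
    Setoid {D : Set (PG2 K) // IsDennistonArc d D} where
  r D E := ∃ g ∈ collineationGroup K, g • D.1 = E.1
  iseqv :=
    { refl := fun D => ⟨1, one_mem _, one_smul _ _⟩
      symm := by
        rintro D E ⟨g, hg, h⟩
        exact ⟨g⁻¹, inv_mem hg, by rw [← h, inv_smul_smul]⟩
      trans := by
        rintro D E F ⟨g, hg, h⟩ ⟨k, hk, h'⟩
        exact ⟨k * g, mul_mem hk hg, by rw [mul_smul, h, h']⟩ }

/-- The isomorphism classes of Denniston arcs of degree `d`. -/
def DennistonClass (K : Type*) [Field K] [Algebra (ZMod 2) K] (d : ℕ) : Type _ :=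
  Quotient (dennistonSetoid K d)

end PG2

open PG2

/-!
The affine part of the plane is identified with the quadratic extension `K[ω]`, `ω² = 1 + ω`, which
is a field because the degree of `K` is odd. In characteristic two its norm is `x² + x y + y²`.
Every `α` of trace one has the form `1 + t + t²` (additive Hilbert 90), so a shear reduces every
pencil to the one with `α = 1`; the conic with parameter `c` becomes the set of the `u` with
`norm u = c`, and the arc of a subgroup `A` the set of the `u` with `norm u ∈ A`.

The decisive step is that a collineation between two arcs respects the pencils
(`matrix_of_dennistonSet_subset`). The image of a conic has `q + 1 > 16` points, so it shares more
than four points with one of the four norm sets of the other arc. On `norm u = c` one has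
`ū = c / u`, so a quadratic form restricts to a polynomial of degree four in `u`, and five zeros
make it a multiple of `norm u - c z²` (`coeff_eq_of_vanishes_on_norm_eq`). Comparing the resulting
identities for two conics shows that the collineation fixes the nucleus and the line at infinity,
that it is a similarity of the norm form, and that it acts on the parameters by a semilinear map
`x ↦ μ σ(x)`.

Conversely every such map is realised, so the isomorphism classes are the orbits of the group of
semilinear maps on the subgroups of order four. That group has order `(q - 1)(2h + 1)`, which is
prime to `24`, so a map that stabilises a subgroup of order four fixes it pointwise; the quotient of
two of its elements then lies outside the prime field and is fixed by `σ`, and as the degree is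
prime, `σ = 1` and `μ = 1` (`eq_one_of_smul_eq`). The action is free, and the number of classes is
`(q - 1)(q - 2) / 6` divided by `(q - 1)(2h + 1)`.

By the same freeness an automorphism of an arc is an isometry of the norm form, that is, a rotation
`u ↦ ε u` or a reflection `u ↦ ε ū` with `norm ε = 1`. The rotations form a cyclic group of order
`q + 1`, which is sharply transitive on each conic and on the line at infinity. The reflections are
the involutions; writing `ε = η / η̄` shows that a reflection is the elation whose axis joins the
nucleus to the point `η` at infinity and whose center is that point.
-/

/-! ### The quadratic extension and its norm form -/

section NormForm

open QuadraticAlgebra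

/-- The algebra `K[ω]` with `ω² = 1 + ω`, whose elements are written `x + y ω`. In characteristic
two `ω` is a primitive cube root of unity, and the algebra is a field if `K` contains none; this is
the hypothesis `∀ r, r ^ 2 ≠ 1 + 1 * r` below, in the form Mathlib's field instance expects. -/
abbrev CubicRootExt (K : Type*) [Field K] : Type _ := QuadraticAlgebra K (1 : K) 1

variable {K : Type*} [Field K]

/-- The units of norm one. -/
def normOneUnits (K : Type*) [Field K] : Subgroup (CubicRootExt K)ˣ :=
  (Units.map (norm : CubicRootExt K →* K)).ker

theorem mem_normOneUnits {ε : (CubicRootExt K)ˣ} :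
    ε ∈ normOneUnits K ↔ norm (ε : CubicRootExt K) = 1 := by
  simp [normOneUnits, MonoidHom.mem_ker, Units.ext_iff]

theorem norm_ne_zero [Fact (∀ r : K, r ^ 2 ≠ 1 + 1 * r)] {u : CubicRootExt K} (hu : u ≠ 0) :
    norm u ≠ 0 :=
  fun h => hu (norm_eq_zero_iff_eq_zero.1 h)

theorem exists_unit_mul_eq_of_norm_eq [Fact (∀ r : K, r ^ 2 ≠ 1 + 1 * r)]
    {u v : CubicRootExt K} (hu : u ≠ 0) (h : norm u = norm v) :
    ∃ ε ∈ normOneUnits K, (ε : CubicRootExt K) * u = v := by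
  have hv : v ≠ 0 := by rintro rfl; exact norm_ne_zero hu (by rw [h, QuadraticAlgebra.norm_zero])
  refine ⟨Units.mk0 v hv * (Units.mk0 u hu)⁻¹, ?_, ?_⟩
  · rw [normOneUnits, MonoidHom.mem_ker, map_mul, map_inv, mul_inv_eq_one]
    ext
    simp [h]
  · simp [hu]

variable [CharP K 2]

theorem exists_sq_eq [Finite K] (c : K) : ∃ s : K, s ^ 2 = c :=
  (Finite.injective_iff_surjective.1 (CharTwo.sq_injective (R := K))) c

theorem norm_eq_sq_add_mul_add_sq (u : CubicRootExt K) :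
    norm u = u.re ^ 2 + u.re * u.im + u.im ^ 2 := by
  rw [norm_def, CharTwo.sub_eq_add]; ring

variable [Fact (∀ r : K, r ^ 2 ≠ 1 + 1 * r)]

instance : CharP (CubicRootExt K) 2 :=
  charP_of_injective_algebraMap (algebraMap_injective (R := K) (a := 1) (b := 1)) 2

/-- A quadric that meets the conic `norm u = c` in more than four points is a multiple of it: on the
conic the conjugate of `u` is `c / u`, which turns the equation of the quadric into a polynomial
equation of degree four for `u`. -/
theorem coeff_eq_of_vanishes_on_norm_eq {a b c' d e f c : K} (S : Finset (CubicRootExt K))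
    (hS : 4 < S.card) (h1 : ∀ u ∈ S, norm u = c)
    (h2 : ∀ u ∈ S, a * u.re ^ 2 + b * u.im ^ 2 + c' + d * (u.re * u.im) + e * u.re + f * u.im = 0) :
    a = d ∧ b = d ∧ e = 0 ∧ f = 0 ∧ c' = d * c := by
  classical
  -- `x = ω² u + ω ū` and `y = u + ū` express the coordinates of `u` by `u` and `ū`; `A`,
  -- `star A`, `E` and `star E` are the coefficients of `u²`, `ū²`, `u` and `ū` in the quadric.
  let A : CubicRootExt K := ⟨b + d, a + d⟩
  let E : CubicRootExt K := ⟨e + f, e⟩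
  let p : Polynomial (CubicRootExt K) := .C A * .X ^ 4 + .C E * .X ^ 3 +
    .C (.C (d * c + c')) * .X ^ 2 + .C (star E * .C c) * .X + .C (star A * .C (c ^ 2))
  have hp : p = 0 := by
    refine Polynomial.eq_zero_of_natDegree_lt_card_of_eval_eq_zero' p S (fun u hu => ?_) ?_
    · have h3 := h1 u hu
      have h4 := h2 u hu
      rw [norm_eq_sq_add_mul_add_sq] at h3
      have : p.eval u = .C (a * u.re ^ 2 + b * u.im ^ 2 + c' + d * (u.re * u.im) + e * u.re +
          f * u.im) * u ^ 2 := by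
        simp only [p, A, E, Polynomial.eval_add, Polynomial.eval_mul, Polynomial.eval_C,
          Polynomial.eval_pow, Polynomial.eval_X]
        subst h3
        have h2 : (2 : K) = 0 := CharTwo.two_eq_zero
        ext
        · simp [pow_succ]
          grind
        · simp [pow_succ]
          grind
      rw [this, h4]; simp
    · refine lt_of_le_of_lt ?_ hS
      simp only [p]
      compute_degree
  have coeffs (A E B D G : CubicRootExt K) (h : (.C A * .X ^ 4 + .C E * .X ^ 3 + .C B * .X ^ 2 +
      .C D * .X + .C G : Polynomial (CubicRootExt K)) = 0) : A = 0 ∧ E = 0 ∧ B = 0 :=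
    ⟨by simpa [Polynomial.coeff_X, Polynomial.coeff_C] using congrArg (Polynomial.coeff · 4) h,
      by simpa [Polynomial.coeff_X, Polynomial.coeff_C] using congrArg (Polynomial.coeff · 3) h,
      by simpa [Polynomial.coeff_X, Polynomial.coeff_C] using congrArg (Polynomial.coeff · 2) h⟩
  obtain ⟨hA, hE, hF⟩ := coeffs _ _ _ _ _ hp
  have h1 := congrArg re hA
  have h2 := congrArg im hA
  have h3 := congrArg re hE
  have h4 := congrArg im hE
  have h5 := congrArg re hF
  simp only [A, E, re_zero, im_zero, re_C] at h1 h2 h3 h4 h5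
  rw [CharTwo.add_eq_zero] at h1 h2 h5
  rw [h4, zero_add] at h3
  exact ⟨h2, h1, h4, h3, h5.symm⟩

/-- An isometry of the norm form is `u ↦ a u` or `u ↦ a ū`. Here `a` and `b` are the images of `1`
and `ω`, and the hypotheses say that the norm form is preserved. -/
theorem isometry_eq_mul_or_mul_star (a b : CubicRootExt K) (ha : norm a = 1) (hb : norm b = 1)
    (hab : a.re * b.im + a.im * b.re = 1) :
    (∀ x y : K, x • a + y • b = a * ⟨x, y⟩) ∨ (∀ x y : K, x • a + y • b = a * star ⟨x, y⟩) := by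
  have h2 : (2 : K) = 0 := CharTwo.two_eq_zero
  set w : CubicRootExt K := star a * b with hw
  have hbw : b = a * w := by
    rw [hw, ← mul_assoc, ← algebraMap_norm_eq_mul_star, ha, map_one, one_mul]
  have him : w.im = 1 := by simp only [hw, im_mul, re_star, im_star]; grind
  have hwn : norm w = 1 := by simp [hw, ha, hb]
  rw [norm_eq_sq_add_mul_add_sq, him] at hwn
  have hre : w.re * (w.re + 1) = 0 := by linear_combination hwn
  rcases mul_eq_zero.1 hre with h | h
  · left
    intro x y
    rw [hbw]
    ext <;> simp [him, h] <;> ring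
  · right
    have h' : w.re = 1 := CharTwo.add_eq_zero.1 h
    intro x y
    rw [hbw]
    ext <;> simp [him, h'] <;> grind

/-- Hilbert's Theorem 90 for the quadratic extension. -/
theorem exists_eq_mul_star_of_norm_eq_one {ε : CubicRootExt K} (h : norm ε = 1) :
    ∃ η : CubicRootExt K, η ≠ 0 ∧ ε * star η = η := by
  have h' : ε * star ε = 1 := by rw [← algebraMap_norm_eq_mul_star, h, map_one]
  by_cases h1 : 1 + ε = 0
  · refine ⟨1, one_ne_zero, ?_⟩
    rw [star_one, mul_one, ← CharTwo.add_eq_zero, add_comm, h1]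
  · refine ⟨1 + ε, h1, ?_⟩
    rw [star_add, star_one, mul_add, h', mul_one, add_comm]

variable [Finite K]

instance : Finite (CubicRootExt K) := Finite.of_equiv _ (equivProd (1 : K) 1).symm

/-- The norm is onto, since it maps `s ∈ K` to `s²`. -/
theorem card_normOneUnits : Nat.card (normOneUnits K) = Nat.card K + 1 := by
  have hs : Function.Surjective (Units.map (norm : CubicRootExt K →* K)) := by
    intro k
    obtain ⟨s, hs⟩ := exists_sq_eq (k : K)
    have h0 : s ≠ 0 := by rintro rfl; exact k.ne_zero (by rw [← hs]; simp)
    refine ⟨Units.map (algebraMap K (CubicRootExt K)).toMonoidHom (Units.mk0 s h0), ?_⟩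
    ext
    simp [hs]
  have h1 := Subgroup.card_eq_card_quotient_mul_card_subgroup (normOneUnits K)
  have h2 : Nat.card ((CubicRootExt K)ˣ ⧸ normOneUnits K) = Nat.card Kˣ :=
    Nat.card_congr (QuotientGroup.quotientKerEquivOfSurjective _ hs).toEquiv
  have h3 : Nat.card (CubicRootExt K) = Nat.card K ^ 2 := by
    rw [Nat.card_congr (equivProd (1 : K) 1), Nat.card_prod, sq]
  rw [h2, Nat.card_units, Nat.card_units, h3] at h1
  have h4 : 1 < Nat.card K := Finite.one_lt_card
  obtain ⟨n, hn⟩ : ∃ n, Nat.card K = n + 2 := ⟨_, (Nat.sub_add_cancel h4).symm⟩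
  rw [hn] at h1 ⊢
  have h5 : (n + 2) ^ 2 - 1 = (n + 2 - 1) * (n + 2 + 1) := by
    rw [show n + 2 - 1 = n + 1 by omega, Nat.sub_eq_iff_eq_add (Nat.one_le_pow _ _ (by omega))]
    ring
  rw [h5] at h1
  exact (Nat.eq_of_mul_eq_mul_left (by omega) h1).symm

theorem card_norm_eq {c : K} (hc : c ≠ 0) :
    Nat.card {u : CubicRootExt K // norm u = c} = Nat.card K + 1 := by
  obtain ⟨s, rfl⟩ := exists_sq_eq c
  rw [← card_normOneUnits]
  have hs : (algebraMap K (CubicRootExt K) s) ≠ 0 := by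
    rw [Ne, map_eq_zero]; rintro rfl; simp at hc
  symm
  refine Nat.card_congr (Equiv.ofBijective
    (fun ε => ⟨ε.1 * algebraMap K _ s, by
      rw [map_mul, mem_normOneUnits.1 ε.2, one_mul, QuadraticAlgebra.norm_algebraMap]⟩)
    ⟨fun ε ε' h => ?_, fun u => ?_⟩)
  · have := mul_right_cancel₀ hs (Subtype.ext_iff.1 h)
    exact Subtype.ext (Units.ext this)
  · obtain ⟨ε, h1, h2⟩ := exists_unit_mul_eq_of_norm_eq hs
      (show norm (algebraMap K (CubicRootExt K) s) = norm u.1 by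
        rw [u.2, QuadraticAlgebra.norm_algebraMap])
    exact ⟨⟨ε, h1⟩, Subtype.ext h2⟩

end NormForm

/-! ### Points, lines and conics in coordinates -/

namespace PG2

open QuadraticAlgebra

section Basic

variable {K : Type*} [Field K]

theorem mem_conic_mk {α β c : K} {v : Fin 3 → K} (hv : v ≠ 0) :
    Projectivization.mk K v hv ∈ conic α β c ↔
      α * v 0 ^ 2 + v 0 * v 1 + β * v 1 ^ 2 + c * v 2 ^ 2 = 0 := by
  obtain ⟨a, ha⟩ := Projectivization.exists_smul_eq_mk_rep K v hv
  simp only [conic, Set.mem_ofPred_eq, ← ha, Pi.smul_apply, Units.smul_def, smul_eq_mul]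
  rw [show α * (a * v 0) ^ 2 + a * v 0 * (a * v 1) + β * (a * v 1) ^ 2 + c * (a * v 2) ^ 2 =
    (a : K) ^ 2 * (α * v 0 ^ 2 + v 0 * v 1 + β * v 1 ^ 2 + c * v 2 ^ 2) by ring]
  simp

theorem mem_lineAtInfinity_mk {v : Fin 3 → K} (hv : v ≠ 0) :
    Projectivization.mk K v hv ∈ (lineAtInfinity : Set (PG2 K)) ↔ v 2 = 0 := by
  obtain ⟨a, ha⟩ := Projectivization.exists_smul_eq_mk_rep K v hv
  simp [lineAtInfinity, ← ha, Units.smul_def]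

theorem mem_line_mk {a v : Fin 3 → K} (ha : a ≠ 0) (hv : v ≠ 0) :
    Projectivization.mk K v hv ∈ line (Projectivization.mk K a ha) ↔
      a 0 * v 0 + a 1 * v 1 + a 2 * v 2 = 0 := by
  rw [line, Set.mem_ofPred_eq, Projectivization.orthogonal_mk ha hv, dotProduct, Fin.sum_univ_three]

theorem isLine_smul {g : Equiv.Perm (PG2 K)} (hg : g ∈ collineationGroup K) {l : Set (PG2 K)}
    (hl : IsLine l) : IsLine (g • l) := by
  obtain ⟨M, σ, hM⟩ := inv_mem hg
  obtain ⟨a, rfl⟩ := hl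
  induction a using Projectivization.ind with
  | h a ha =>
    have h0 : (fun i => σ.symm (Matrix.vecMul a M.val i)) ≠ 0 := by
      intro h
      apply ha
      have h1 : Matrix.vecMul a M.val = 0 := by
        funext i
        simpa using congrFun h i
      have h2 : Matrix.vecMul (Matrix.vecMul a M.val) (M⁻¹).val = 0 := by
        rw [h1, Matrix.zero_vecMul]
      rwa [Matrix.vecMul_vecMul, ← Units.val_mul, mul_inv_cancel, Units.val_one,
        Matrix.vecMul_one] at h2
    refine ⟨Projectivization.mk K _ h0, ?_⟩
    ext P
    rw [Set.mem_smul_set_iff_inv_smul_mem, Equiv.Perm.smul_def]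
    induction P using Projectivization.ind with
    | h v hv =>
      obtain ⟨hw, e⟩ := hM v hv
      rw [e, line, line, Set.mem_ofPred_eq, Set.mem_ofPred_eq, Projectivization.orthogonal_mk ha hw,
        Projectivization.orthogonal_mk h0 hv, Matrix.dotProduct_mulVec]
      have : (fun i => σ.symm (Matrix.vecMul a M.val i)) ⬝ᵥ v =
          σ.symm (Matrix.vecMul a M.val ⬝ᵥ fun i => σ (v i)) := by
        simp only [dotProduct, map_sum, map_mul, RingEquiv.symm_apply_apply]
      rw [this, map_eq_zero_iff _ σ.symm.injective]

theorem isLine_smul_iff {g : Equiv.Perm (PG2 K)} (hg : g ∈ collineationGroup K)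
    {l : Set (PG2 K)} : IsLine (g • l) ↔ IsLine l :=
  ⟨fun h => by simpa using isLine_smul (inv_mem hg) h, isLine_smul hg⟩

/-- Elations are carried to elations by collineations. -/
theorem IsElation.conj {g e : Equiv.Perm (PG2 K)} (hg : g ∈ collineationGroup K) {z : PG2 K}
    {l : Set (PG2 K)} (he : IsElation e z l) : IsElation (g * e * g⁻¹) (g z) (g • l) where
  mem_collineationGroup := mul_mem (mul_mem hg he.mem_collineationGroup) (inv_mem hg)
  ne_one h := he.ne_one (by
    rw [mul_inv_eq_one] at h
    exact mul_left_cancel (h.trans (mul_one g).symm))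
  isLine := isLine_smul hg he.isLine
  center_mem := Set.smul_mem_smul_set he.center_mem
  fix_axis := by
    rintro _ ⟨P, hP, rfl⟩
    simp [he.fix_axis P hP]
  fix_center := by
    intro m hm hz
    have h1 := he.fix_center (g⁻¹ • m) (isLine_smul (inv_mem hg) hm)
      (by rw [Set.mem_inv_smul_set_iff]; exact hz)
    rw [mul_smul, mul_smul, h1, smul_inv_smul]

theorem isElation_conj_iff {g e : Equiv.Perm (PG2 K)} (hg : g ∈ collineationGroup K) {z : PG2 K}
    {l : Set (PG2 K)} : IsElation (g * e * g⁻¹) (g z) (g • l) ↔ IsElation e z l := by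
  refine ⟨fun h => ?_, fun h => h.conj hg⟩
  have := h.conj (inv_mem hg)
  simpa [mul_assoc] using this

/-- The permutation of the points induced by an invertible matrix and a field automorphism. -/
theorem exists_induces [Finite K] (M : GL (Fin 3) K) (σ : K ≃+* K) :
    ∃ g ∈ collineationGroup K, Induces M σ g := by
  let f : PG2 K → PG2 K :=
    Projectivization.lift (fun v => Projectivization.mk K (M.val.mulVec fun i => σ (v.1 i))
      (mulVec_map_ne_zero M σ v.2)) (by
        rintro ⟨v, hv⟩ ⟨w, hw⟩ t h
        rw [Projectivization.mk_eq_mk_iff']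
        refine ⟨σ t, ?_⟩
        simp only at h
        subst h
        rw [← Matrix.mulVec_smul]
        congr 1
        funext i
        simp)
  have hf (v hv) : f (Projectivization.mk K v hv) =
    Projectivization.mk K (M.val.mulVec fun i => σ (v i)) (mulVec_map_ne_zero M σ hv) := rfl
  have hinj : Function.Injective f := by
    intro P Q h
    induction P using Projectivization.ind with
    | h v hv =>
    induction Q using Projectivization.ind with
    | h w hw =>
      rw [hf, hf, Projectivization.mk_eq_mk_iff'] at h
      obtain ⟨t, ht⟩ := h
      rw [Projectivization.mk_eq_mk_iff']
      refine ⟨σ.symm t, sub_eq_zero.1 ?_⟩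
      by_contra h0
      refine mulVec_map_ne_zero M σ h0 ?_
      have : (fun i => σ ((σ.symm t • w - v) i)) = t • (fun i => σ (w i)) - fun i => σ (v i) := by
        funext i
        simp
      rw [this, Matrix.mulVec_sub, Matrix.mulVec_smul, ht, sub_self]
  let g := Equiv.ofBijective f (Finite.injective_iff_bijective.1 hinj)
  have hg : Induces M σ g := fun v hv => ⟨mulVec_map_ne_zero M σ hv, hf v hv⟩
  exact ⟨g, ⟨M, σ, hg⟩, hg⟩

end Basic

section Pencil

variable {K : Type*} [Field K]

/-- The affine point `(x, y, 1)`, with `(x, y)` read as `x + y ω`. -/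
def affinePoint (u : CubicRootExt K) : PG2 K :=
  Projectivization.mk K ![u.re, u.im, 1] (fun h => one_ne_zero (congrFun h 2))

theorem infPoint_ne_zero {u : CubicRootExt K} (hu : u ≠ 0) : ![u.re, u.im, 0] ≠ 0 := fun h =>
  hu (QuadraticAlgebra.ext (congrFun h 0) (congrFun h 1))

/-- The point `(x, y, 0)` at infinity, with `(x, y)` read as `x + y ω`. -/
def infPoint (u : CubicRootExt K) (hu : u ≠ 0) : PG2 K :=
  Projectivization.mk K ![u.re, u.im, 0] (infPoint_ne_zero hu)

theorem affinePoint_injective : Function.Injective (affinePoint (K := K)) := by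
  intro u v h
  rw [affinePoint, affinePoint, Projectivization.mk_eq_mk_iff'] at h
  obtain ⟨a, ha⟩ := h
  have h0 := congrFun ha 0
  have h1 := congrFun ha 1
  have h2 := congrFun ha 2
  simp at h0 h1 h2
  subst h2
  ext <;> simp_all

theorem affinePoint_ne_infPoint (u : CubicRootExt K) {v : CubicRootExt K} (hv : v ≠ 0) :
    affinePoint u ≠ infPoint v hv := by
  intro h
  rw [affinePoint, infPoint, Projectivization.mk_eq_mk_iff'] at h
  obtain ⟨a, ha⟩ := h
  have h2 := congrFun ha 2
  simp at h2

theorem infPoint_eq_iff {u v : CubicRootExt K} (hu : u ≠ 0) (hv : v ≠ 0) :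
    infPoint u hu = infPoint v hv ↔ ∃ a : K, a • v = u := by
  rw [infPoint, infPoint, Projectivization.mk_eq_mk_iff']
  refine exists_congr fun a => ⟨fun h => ?_, fun h => ?_⟩
  · ext
    · simpa using congrFun h 0
    · simpa using congrFun h 1
  · subst h
    funext i
    fin_cases i <;> simp

theorem eq_affinePoint_or_infPoint (P : PG2 K) :
    (∃ u, P = affinePoint u) ∨ ∃ u hu, P = infPoint u hu := by
  induction P using Projectivization.ind with
  | h v hv =>
    by_cases h2 : v 2 = 0
    · right
      have hu : (⟨v 0, v 1⟩ : CubicRootExt K) ≠ 0 := by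
        intro h
        apply hv
        funext i
        fin_cases i
        · exact congrArg re h
        · exact congrArg im h
        · exact h2
      refine ⟨⟨v 0, v 1⟩, hu, ?_⟩
      rw [infPoint]
      congr 1
      funext i
      fin_cases i <;> simp [h2]
    · left
      refine ⟨⟨v 0 / v 2, v 1 / v 2⟩, ?_⟩
      rw [affinePoint, Projectivization.mk_eq_mk_iff']
      refine ⟨v 2, ?_⟩
      funext i
      fin_cases i
      · exact mul_div_cancel₀ _ h2
      · exact mul_div_cancel₀ _ h2
      · exact mul_one _

theorem origin_eq_affinePoint : (origin : PG2 K) = affinePoint 0 := by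
  rw [origin, affinePoint]
  congr 1

theorem mem_lineAtInfinity_iff {P : PG2 K} : P ∈ (lineAtInfinity : Set (PG2 K)) ↔
    ∃ u hu, P = infPoint u hu := by
  rcases eq_affinePoint_or_infPoint P with ⟨u, rfl⟩ | ⟨u, hu, rfl⟩
  · refine ⟨fun h => ?_, ?_⟩
    · rw [affinePoint, mem_lineAtInfinity_mk] at h
      simp at h
    · rintro ⟨v, hv, h⟩
      exact absurd h (affinePoint_ne_infPoint u hv)
  · exact ⟨fun _ => ⟨u, hu, rfl⟩, fun _ => by rw [infPoint, mem_lineAtInfinity_mk]; rfl⟩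

/-- The extension to the plane of a linear map of the affine part. -/
def extendEquiv (T : CubicRootExt K ≃ₗ[K] CubicRootExt K) : (Fin 3 → K) ≃ₗ[K] (Fin 3 → K) where
  toFun v := ![(T ⟨v 0, v 1⟩).re, (T ⟨v 0, v 1⟩).im, v 2]
  invFun v := ![(T.symm ⟨v 0, v 1⟩).re, (T.symm ⟨v 0, v 1⟩).im, v 2]
  map_add' v w := by
    have : (⟨v 0 + w 0, v 1 + w 1⟩ : CubicRootExt K) = ⟨v 0, v 1⟩ + ⟨w 0, w 1⟩ := rfl
    funext i
    fin_cases i <;> simp [this]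
  map_smul' a v := by
    have : T ⟨a * v 0, a * v 1⟩ = a • T ⟨v 0, v 1⟩ := T.map_smul a ⟨v 0, v 1⟩
    funext i
    fin_cases i
    · exact congrArg re this
    · exact congrArg im this
    · rfl
  left_inv v := by
    funext i
    fin_cases i <;> simp
  right_inv v := by
    funext i
    fin_cases i <;> simp

/-- The action on the plane of the linear maps of the affine part. -/
def extend : (CubicRootExt K ≃ₗ[K] CubicRootExt K) →* Equiv.Perm (PG2 K) :=
  (MulAction.toPermHom ((Fin 3 → K) ≃ₗ[K] (Fin 3 → K)) (PG2 K)).comp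
    { toFun := extendEquiv
      map_one' := by
        ext v i
        fin_cases i <;> simp [extendEquiv]
      map_mul' := fun S T => by
        ext v i
        fin_cases i <;> simp [extendEquiv] }

theorem extend_affinePoint (T : CubicRootExt K ≃ₗ[K] CubicRootExt K) (u : CubicRootExt K) :
    extend T (affinePoint u) = affinePoint (T u) := rfl

theorem mem_collineationGroup_of_linearEquiv (T : (Fin 3 → K) ≃ₗ[K] (Fin 3 → K)) :
    MulAction.toPermHom _ (PG2 K) T ∈ collineationGroup K := by
  refine ⟨Matrix.GeneralLinearGroup.toLin.symm
    (LinearMap.GeneralLinearGroup.ofLinearEquiv T), RingEquiv.refl K, fun v hv => ?_⟩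
  refine ⟨mulVec_map_ne_zero _ _ hv, ?_⟩
  rw [MulAction.toPermHom_apply, MulAction.toPerm_apply, Projectivization.smul_mk]
  congr 1
  exact (LinearMap.toMatrix'_mulVec T.toLinearMap v).symm

theorem extend_mem_collineationGroup (T : CubicRootExt K ≃ₗ[K] CubicRootExt K) :
    extend T ∈ collineationGroup K :=
  mem_collineationGroup_of_linearEquiv (extendEquiv T)

end Pencil

end PG2

/-! ### Collineations between Denniston arcs -/

namespace PG2

open QuadraticAlgebra

theorem exists_ne_of_card_eq_four {K : Type*} [AddGroup K] [Finite K] {A : AddSubgroup K}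
    (hA : Nat.card A = 4) : ∃ a ∈ A, ∃ b ∈ A, a ≠ 0 ∧ b ≠ 0 ∧ a ≠ b := by
  classical
  have := Fintype.ofFinite A
  rw [Nat.card_eq_fintype_card] at hA
  obtain ⟨a, ha⟩ := Fintype.exists_ne_of_one_lt_card (by omega) (0 : A)
  obtain ⟨b, hb, hb'⟩ : ∃ b : A, b ≠ 0 ∧ b ≠ a := by
    have : (({0, a} : Finset A)ᶜ).Nonempty := by
      rw [← Finset.card_pos, Finset.card_compl, hA, Finset.card_pair ha.symm]
      norm_num
    obtain ⟨b, hb⟩ := this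
    exact ⟨b, by simpa using hb⟩
  exact ⟨a, a.2, b, b.2, by simpa using ha, by simpa using hb, fun h => hb' (Subtype.ext h.symm)⟩

section Core

variable {K : Type*} [Field K]

/-- The rotation `[u, z] ↦ [ε u, z]` of the plane. -/
def rotation : (CubicRootExt K)ˣ →* Equiv.Perm (PG2 K) :=
  extend.comp (DistribMulAction.toModuleAut K (CubicRootExt K))

/-- The conjugation `u ↦ ū` as a linear map. -/
def starEquiv (K : Type*) [Field K] : CubicRootExt K ≃ₗ[K] CubicRootExt K where
  toFun u := star u
  invFun u := star u
  map_add' u v := star_add u v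
  map_smul' a u := by ext <;> simp; ring
  left_inv u := star_star u
  right_inv u := star_star u

/-- The involution `[u, z] ↦ [ū, z]` of the plane. -/
def flip (K : Type*) [Field K] : Equiv.Perm (PG2 K) := extend (starEquiv K)

theorem rotation_affinePoint (ε : (CubicRootExt K)ˣ) (u : CubicRootExt K) :
    rotation ε (affinePoint u) = affinePoint ((ε : CubicRootExt K) * u) := rfl

theorem rotation_infPoint (ε : (CubicRootExt K)ˣ) {u : CubicRootExt K} (hu : u ≠ 0) :
    rotation ε (infPoint u hu) =
      infPoint ((ε : CubicRootExt K) * u) (ε.mul_right_eq_zero.not.2 hu) := rfl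

variable [CharP K 2]

theorem affinePoint_mem_conic {u : CubicRootExt K} {c : K} :
    affinePoint u ∈ conic 1 1 c ↔ norm u = c := by
  rw [affinePoint, mem_conic_mk, norm_eq_sq_add_mul_add_sq]
  conv_rhs => rw [← CharTwo.add_eq_zero]
  simp

variable [Fact (∀ r : K, r ^ 2 ≠ 1 + 1 * r)]

theorem infPoint_notMem_conic {u : CubicRootExt K} (hu : u ≠ 0) (c : K) :
    infPoint u hu ∉ conic 1 1 c := by
  rw [infPoint, mem_conic_mk]
  have := norm_ne_zero hu
  rw [norm_eq_sq_add_mul_add_sq] at this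
  simpa using this

theorem mem_conic_iff {P : PG2 K} {c : K} :
    P ∈ conic 1 1 c ↔ ∃ u, P = affinePoint u ∧ norm u = c := by
  rcases eq_affinePoint_or_infPoint P with ⟨u, rfl⟩ | ⟨u, hu, rfl⟩
  · rw [affinePoint_mem_conic]
    exact ⟨fun h => ⟨u, rfl, h⟩, fun ⟨v, h1, h2⟩ => by rwa [affinePoint_injective h1]⟩
  · exact ⟨fun h => absurd h (infPoint_notMem_conic hu c),
      fun ⟨v, h1, _⟩ => absurd h1.symm (affinePoint_ne_infPoint v hu)⟩

theorem mem_dennistonSet_iff {P : PG2 K} {A : AddSubgroup K} :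
    P ∈ dennistonSet 1 A ↔ ∃ u, P = affinePoint u ∧ norm u ∈ A := by
  simp only [dennistonSet, Set.mem_union, Set.mem_singleton_iff, Set.mem_iUnion, mem_conic_iff,
    Set.mem_ofPred_eq, exists_prop, origin_eq_affinePoint]
  constructor
  · rintro (rfl | ⟨c, ⟨hc, -⟩, u, rfl, rfl⟩)
    · exact ⟨0, rfl, by simp [A.zero_mem]⟩
    · exact ⟨u, rfl, hc⟩
  · rintro ⟨u, rfl, h⟩
    by_cases hu : u = 0
    · exact Or.inl (by rw [hu])
    · exact Or.inr ⟨norm u, ⟨h, norm_ne_zero hu⟩, u, rfl, rfl⟩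

theorem affinePoint_mem_dennistonSet {u : CubicRootExt K} {A : AddSubgroup K} :
    affinePoint u ∈ dennistonSet 1 A ↔ norm u ∈ A := by
  rw [mem_dennistonSet_iff]
  exact ⟨fun ⟨v, h1, h2⟩ => by rwa [affinePoint_injective h1], fun h => ⟨u, rfl, h⟩⟩

/-- A linear collineation that preserves the norm form of the affine part up to the scaling of `z`
is a rotation or a reflection. -/
theorem eq_rotation_or_rotation_mul_flip {M : GL (Fin 3) K}
    {g : Equiv.Perm (PG2 K)} (hg : Induces M (RingEquiv.refl K) g) (h22 : M.val 2 2 ≠ 0)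
    (h0 : M.val 2 0 = 0 ∧ M.val 2 1 = 0 ∧ M.val 0 2 = 0 ∧ M.val 1 2 = 0)
    (h1 : norm (⟨M.val 0 0, M.val 1 0⟩ : CubicRootExt K) = M.val 2 2 ^ 2 ∧
      norm (⟨M.val 0 1, M.val 1 1⟩ : CubicRootExt K) = M.val 2 2 ^ 2 ∧
      M.val 0 0 * M.val 1 1 + M.val 1 0 * M.val 0 1 = M.val 2 2 ^ 2) :
    ∃ ε ∈ normOneUnits K, g = rotation ε ∨ g = rotation ε * flip K := by
  obtain ⟨h20, h21, h02, h12⟩ := h0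
  set m := M.val 2 2 with hm
  set a : CubicRootExt K := ⟨M.val 0 0 / m, M.val 1 0 / m⟩ with ha
  set b : CubicRootExt K := ⟨M.val 0 1 / m, M.val 1 1 / m⟩ with hb
  obtain ⟨n1, n2, n3⟩ := h1
  rw [norm_eq_sq_add_mul_add_sq] at n1 n2
  have na : norm a = 1 := by
    rw [norm_eq_sq_add_mul_add_sq, ha]
    field_simp
    linear_combination n1
  have nb : norm b = 1 := by
    rw [norm_eq_sq_add_mul_add_sq, hb]
    field_simp
    linear_combination n2
  have nab : a.re * b.im + a.im * b.re = 1 := by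
    rw [ha, hb]
    field_simp
    linear_combination n3
  have ha0 : a ≠ 0 := by
    rintro h
    rw [h] at na
    simp at na
  have hgT : ∀ T : CubicRootExt K ≃ₗ[K] CubicRootExt K,
      (∀ x y : K, x • a + y • b = T ⟨x, y⟩) → g = extend T := by
    intro T hT
    have hv : ∀ v : Fin 3 → K, M.val.mulVec v =
        m • ![(T ⟨v 0, v 1⟩).re, (T ⟨v 0, v 1⟩).im, v 2] := by
      intro v
      rw [← hT]
      funext i
      fin_cases i
      · simp [Matrix.mulVec, dotProduct, Fin.sum_univ_three, h02, ha, hb]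
        field_simp
      · simp [Matrix.mulVec, dotProduct, Fin.sum_univ_three, h12, ha, hb]
        field_simp
      · simp [Matrix.mulVec, dotProduct, Fin.sum_univ_three, h20, h21, hm]
    ext P
    induction P using Projectivization.ind with
    | h v hv0 =>
      obtain ⟨hw, e⟩ := hg v hv0
      rw [e]
      exact (Projectivization.mk_eq_mk_iff' _ _ _ _ _).2 ⟨m, (hv v).symm⟩
  refine ⟨Units.mk0 a ha0, mem_normOneUnits.2 na, ?_⟩
  refine (isometry_eq_mul_or_mul_star a b na nb nab).imp (fun h => ?_) (fun h => ?_)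
  · exact hgT _ h
  · rw [rotation, flip, MonoidHom.comp_apply, ← map_mul]
    exact hgT _ h

variable [Finite K]

/-- By the pigeonhole principle, the preimage of a conic of the first arc has more than four points
in common with one of the sets `norm u = b` of the second arc. -/
theorem exists_large_intersection (hq : 16 ≤ Nat.card K) {g : Equiv.Perm (PG2 K)}
    {A B : AddSubgroup K} (hB : Nat.card B = 4)
    (h : dennistonSet 1 A ⊆ g • dennistonSet 1 B) {a : K} (ha : a ∈ A) (ha0 : a ≠ 0) :
    ∃ b ∈ B, ∃ S : Finset (CubicRootExt K), 4 < S.card ∧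
      ∀ u ∈ S, norm u = b ∧ g (affinePoint u) ∈ conic 1 1 a := by
  classical
  have := Fintype.ofFinite K
  have := Fintype.ofFinite (CubicRootExt K)
  have key : ∀ w : {w : CubicRootExt K // norm w = a}, ∃ u, g (affinePoint u) = affinePoint w.1 ∧
      norm u ∈ B := by
    rintro ⟨w, rfl⟩
    obtain ⟨P, hP, hPw⟩ := h (affinePoint_mem_dennistonSet.2 ha)
    obtain ⟨u, rfl, hu⟩ := mem_dennistonSet_iff.1 hP
    exact ⟨u, hPw, hu⟩
  choose f hf hfB using key
  have hinj : Function.Injective f := by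
    intro w w' hw
    apply Subtype.ext
    apply affinePoint_injective
    rw [← hf, ← hf, hw]
  let S := Finset.univ.image f
  have hS : S.card = Nat.card K + 1 := by
    rw [Finset.card_image_of_injective _ hinj, Finset.card_univ, ← Nat.card_eq_fintype_card,
      card_norm_eq ha0]
  have hT : (Set.toFinset (B : Set K)).card = 4 := by
    rw [← hB, Set.toFinset_card, Nat.card_eq_fintype_card]
    rfl
  obtain ⟨b, hb, hlt⟩ := Finset.exists_lt_card_fiber_of_mul_lt_card_of_maps_to (s := S)
    (t := Set.toFinset (B : Set K)) (f := fun u => norm u) (n := 4) (by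
      intro u hu
      obtain ⟨w, -, rfl⟩ := Finset.mem_image.1 hu
      simpa using hfB w) (by rw [hS, hT]; omega)
  refine ⟨b, by simpa using hb, _, hlt, fun u hu => ?_⟩
  obtain ⟨hu1, hu2⟩ := Finset.mem_filter.1 hu
  obtain ⟨w, -, rfl⟩ := Finset.mem_image.1 hu1
  refine ⟨hu2, ?_⟩
  rw [hf, affinePoint_mem_conic, w.2]

/-- The quadratic form of a conic of the first arc pulls back to a multiple of the form of a conic
of the second arc. -/
theorem exists_pullback_conic (hq : 16 ≤ Nat.card K) {M : GL (Fin 3) K} {σ : K ≃+* K}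
    {g : Equiv.Perm (PG2 K)} (hg : Induces M σ g) {A B : AddSubgroup K} (hB : Nat.card B = 4)
    (h : dennistonSet 1 A ⊆ g • dennistonSet 1 B) {a : K} (ha : a ∈ A) (ha0 : a ≠ 0) :
    ∃ b ∈ B,
      M.val 0 0 ^ 2 + M.val 0 0 * M.val 1 0 + M.val 1 0 ^ 2 + a * M.val 2 0 ^ 2 =
        M.val 0 0 * M.val 1 1 + M.val 0 1 * M.val 1 0 ∧
      M.val 0 1 ^ 2 + M.val 0 1 * M.val 1 1 + M.val 1 1 ^ 2 + a * M.val 2 1 ^ 2 =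
        M.val 0 0 * M.val 1 1 + M.val 0 1 * M.val 1 0 ∧
      M.val 0 0 * M.val 1 2 + M.val 0 2 * M.val 1 0 = 0 ∧
      M.val 0 1 * M.val 1 2 + M.val 0 2 * M.val 1 1 = 0 ∧
      M.val 0 2 ^ 2 + M.val 0 2 * M.val 1 2 + M.val 1 2 ^ 2 + a * M.val 2 2 ^ 2 =
        (M.val 0 0 * M.val 1 1 + M.val 0 1 * M.val 1 0) * σ b := by
  classical
  obtain ⟨b, hb, S, hS, hSb⟩ := exists_large_intersection hq hB h ha ha0
  have hinj : Function.Injective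
      (fun u : CubicRootExt K => (⟨σ u.re, σ u.im⟩ : CubicRootExt K)) := by
    intro u v huv
    ext
    · exact σ.injective (congrArg re huv)
    · exact σ.injective (congrArg im huv)
  refine ⟨b, hb, coeff_eq_of_vanishes_on_norm_eq (S.image fun u => ⟨σ u.re, σ u.im⟩)
    (by rwa [Finset.card_image_of_injective _ hinj]) ?_ ?_⟩
  · intro u hu
    obtain ⟨v, hv, rfl⟩ := Finset.mem_image.1 hu
    rw [← (hSb v hv).1, norm_eq_sq_add_mul_add_sq, norm_eq_sq_add_mul_add_sq]
    simp
  · intro u hu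
    obtain ⟨v, hv, rfl⟩ := Finset.mem_image.1 hu
    have h1 := (hSb v hv).2
    obtain ⟨hw, e⟩ := hg ![v.re, v.im, 1] (fun h => one_ne_zero (congrFun h 2))
    rw [affinePoint, e, mem_conic_mk] at h1
    simp only [Matrix.mulVec, dotProduct, Fin.sum_univ_three] at h1
    simp at h1
    have h2 : (2 : K) = 0 := CharTwo.two_eq_zero
    grind

/-- A collineation between two Denniston arcs of degree four fixes the nucleus and the line at
infinity and acts on the affine part as a similarity of the norm form. -/
theorem matrix_of_dennistonSet_subset (hq : 16 ≤ Nat.card K) {M : GL (Fin 3) K} {σ : K ≃+* K}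
    {g : Equiv.Perm (PG2 K)} (hg : Induces M σ g) {A B : AddSubgroup K} (hA : Nat.card A = 4)
    (hB : Nat.card B = 4) (h : dennistonSet 1 A ⊆ g • dennistonSet 1 B) :
    ∃ k : K, k ≠ 0 ∧ M.val 2 2 ≠ 0 ∧
      (M.val 2 0 = 0 ∧ M.val 2 1 = 0 ∧ M.val 0 2 = 0 ∧ M.val 1 2 = 0) ∧
      (norm (⟨M.val 0 0, M.val 1 0⟩ : CubicRootExt K) = k ∧
      norm (⟨M.val 0 1, M.val 1 1⟩ : CubicRootExt K) = k ∧
      M.val 0 0 * M.val 1 1 + M.val 1 0 * M.val 0 1 = k) ∧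
      ∀ a ∈ A, ∃ b ∈ B, a * M.val 2 2 ^ 2 = k * σ b := by
  have key := fun a => exists_pullback_conic (a := a) hq hg hB h
  -- The pullbacks of two conics have the same `x y` coefficient, so their difference shows that
  -- the last row of `M` is `(0, 0, *)`; Cramer's rule then gives the last column.
  obtain ⟨a, ha, a', ha', ha0, ha0', hne⟩ := exists_ne_of_card_eq_four hA
  have hcol : ∀ j : Fin 3, M.val 0 j = 0 → M.val 1 j = 0 → M.val 2 j = 0 → False := by
    intro j h0 h1 h2
    refine mulVec_map_ne_zero M (RingEquiv.refl K) (v := Pi.single j 1)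
      (fun h => one_ne_zero (α := K) (by simpa using congrFun h j)) ?_
    funext i
    fin_cases i <;> simpa
  obtain ⟨b, hb, x1, y1, e1, f1, c1⟩ := key a ha ha0
  obtain ⟨b', hb', x2, y2, -, -, c2⟩ := key a' ha' ha0'
  have hsub : a - a' ≠ 0 := sub_ne_zero.2 hne
  have h20 : M.val 2 0 = 0 := by
    have : (a - a') * M.val 2 0 ^ 2 = 0 := by linear_combination x1 - x2
    simpa [hsub] using this
  have h21 : M.val 2 1 = 0 := by
    have : (a - a') * M.val 2 1 ^ 2 = 0 := by linear_combination y1 - y2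
    simpa [hsub] using this
  have h2 : (2 : K) = 0 := CharTwo.two_eq_zero
  have hk : M.val 0 0 * M.val 1 1 + M.val 1 0 * M.val 0 1 ≠ 0 := by
    intro h0
    have h3 : norm (⟨M.val 0 0, M.val 1 0⟩ : CubicRootExt K) = 0 := by
      rw [norm_eq_sq_add_mul_add_sq]
      rw [h20] at x1
      linear_combination x1 + h0
    have h4 := norm_eq_zero_iff_eq_zero.1 h3
    exact hcol 0 (congrArg re h4) (congrArg im h4) h20
  have h02 : M.val 0 2 = 0 := by
    have : M.val 0 2 * (M.val 0 0 * M.val 1 1 + M.val 1 0 * M.val 0 1) = 0 := by grind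
    simpa [hk] using this
  have h12 : M.val 1 2 = 0 := by
    have : M.val 1 2 * (M.val 0 0 * M.val 1 1 + M.val 1 0 * M.val 0 1) = 0 := by grind
    simpa [hk] using this
  refine ⟨_, hk, fun h => hcol 2 h02 h12 h, ⟨h20, h21, h02, h12⟩, ⟨?_, ?_, rfl⟩, fun c hc => ?_⟩
  · rw [norm_eq_sq_add_mul_add_sq]
    rw [h20] at x1
    linear_combination x1
  · rw [norm_eq_sq_add_mul_add_sq]
    rw [h21] at y1
    linear_combination y1
  · by_cases hc0 : c = 0
    · exact ⟨0, B.zero_mem, by simp [hc0]⟩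
    · obtain ⟨d, hd, -, -, -, -, e⟩ := key c hc hc0
      refine ⟨d, hd, ?_⟩
      rw [h02, h12] at e
      linear_combination e

end Core

end PG2

/-! ### Additive subgroups of order four up to semilinear maps -/

theorem card_ne_pairs (T : Type*) [Finite T] [Zero T] :
    Nat.card {p : T × T // p.1 ≠ 0 ∧ p.2 ≠ 0 ∧ p.1 ≠ p.2} =
      (Nat.card T - 1) * (Nat.card T - 2) := by
  classical
  have := Fintype.ofFinite T
  have h : ∀ p : T × T, p ∈ (Finset.univ.erase (0 : T)).offDiag ↔
      p.1 ≠ 0 ∧ p.2 ≠ 0 ∧ p.1 ≠ p.2 := by simp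
  rw [← Nat.card_congr (Equiv.subtypeEquivRight h), Nat.card_eq_fintype_card, Fintype.card_coe,
    Finset.offDiag_card, Finset.card_erase_of_mem (Finset.mem_univ _), Finset.card_univ,
    ← Nat.card_eq_fintype_card, ← Nat.mul_sub_one, Nat.sub_sub]

/-- The subgroup `{0, a, b, a + b}` of a group of exponent two. -/
def kleinFour {K : Type*} [AddCommGroup K] (h2 : ∀ x : K, x + x = 0) (a b : K) : AddSubgroup K where
  carrier := {0, a, b, a + b}
  zero_mem' := by simp
  add_mem' := by
    rintro x y (rfl | rfl | rfl | rfl) (rfl | rfl | rfl | rfl) <;>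
      simp [h2, add_comm, add_left_comm]
  neg_mem' := by
    intro x hx
    rwa [neg_eq_of_add_eq_zero_left (h2 x)]

section FourSubgroups

variable {K : Type*} [AddCommGroup K]

theorem left_mem_kleinFour (h2 : ∀ x : K, x + x = 0) (a b : K) : a ∈ kleinFour h2 a b :=
  Or.inr (Or.inl rfl)

theorem right_mem_kleinFour (h2 : ∀ x : K, x + x = 0) (a b : K) : b ∈ kleinFour h2 a b :=
  Or.inr (Or.inr (Or.inl rfl))

theorem card_kleinFour (h2 : ∀ x : K, x + x = 0) {a b : K} (ha : a ≠ 0) (hb : b ≠ 0) (hab : a ≠ b) :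
    Nat.card (kleinFour h2 a b) = 4 := by
  classical
  have h0 : a + b ≠ 0 := fun h => hab (add_right_cancel (h.trans (h2 b).symm))
  have h : ((({0, a, b, a + b} : Finset K) : Set K)) = (kleinFour h2 a b : Set K) := by
    simp [kleinFour]
  change Nat.card (kleinFour h2 a b : Set K) = 4
  rw [← h, Nat.card_coe_set_eq, Set.ncard_coe_finset]
  simp [Finset.card_insert_of_notMem, ha, hb, hab, ha.symm, hb.symm, h0.symm]

theorem eq_kleinFour [Finite K] (h2 : ∀ x : K, x + x = 0) {a b : K}
    (ha : a ≠ 0) (hb : b ≠ 0) (hab : a ≠ b) {A : AddSubgroup K}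
    (hA : Nat.card A = 4) (haA : a ∈ A) (hbA : b ∈ A) : kleinFour h2 a b = A := by
  refine AddSubgroup.eq_of_le_of_card_ge ?_ (by rw [hA, card_kleinFour h2 ha hb hab])
  rintro x (rfl | rfl | rfl | rfl)
  exacts [A.zero_mem, haA, hbA, A.add_mem haA hbA]

/-- A subgroup of order four contains six ordered pairs of distinct nonzero elements, and each pair
lies in exactly one of them. -/
theorem card_subgroups_of_card_four [Finite K] (h2 : ∀ x : K, x + x = 0) :
    Nat.card {A : AddSubgroup K // Nat.card A = 4} * 6 = (Nat.card K - 1) * (Nat.card K - 2) := by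
  rw [← card_ne_pairs K]
  let e : {p : K × K // p.1 ≠ 0 ∧ p.2 ≠ 0 ∧ p.1 ≠ p.2} ≃
      Σ A : {A : AddSubgroup K // Nat.card A = 4},
        {p : A.1 × A.1 // p.1 ≠ 0 ∧ p.2 ≠ 0 ∧ p.1 ≠ p.2} :=
    { toFun := fun p => ⟨⟨kleinFour h2 p.1.1 p.1.2, card_kleinFour h2 p.2.1 p.2.2.1 p.2.2.2⟩,
        ⟨(⟨p.1.1, left_mem_kleinFour h2 _ _⟩, ⟨p.1.2, right_mem_kleinFour h2 _ _⟩), by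
          simpa [Subtype.ext_iff] using p.2⟩⟩
      invFun := fun x => ⟨(x.2.1.1, x.2.1.2), fun h => x.2.2.1 (Subtype.ext h),
        fun h => x.2.2.2.1 (Subtype.ext h), fun h => x.2.2.2.2 (Subtype.ext h)⟩
      left_inv := fun p => rfl
      right_inv := by
        rintro ⟨⟨A, hA⟩, ⟨⟨⟨a, ha⟩, ⟨b, hb⟩⟩, h⟩⟩
        have := eq_kleinFour h2 (a := a) (b := b) (by simpa [Subtype.ext_iff] using h.1)
          (by simpa [Subtype.ext_iff] using h.2.1) (by simpa [Subtype.ext_iff] using h.2.2) hA ha hb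
        subst this
        rfl }
  have h6 : ∀ A : {A : AddSubgroup K // Nat.card A = 4},
      Nat.card {p : A.1 × A.1 // p.1 ≠ 0 ∧ p.2 ≠ 0 ∧ p.1 ≠ p.2} = 6 := fun A => by
    rw [card_ne_pairs, A.2]
  have := Fintype.ofFinite {A : AddSubgroup K // Nat.card A = 4}
  rw [Nat.card_congr e, Nat.card_sigma, Finset.sum_congr rfl (fun A _ => h6 A)]
  simp [Nat.card_eq_fintype_card]

end FourSubgroups

section Semilinear

variable (K : Type*) [Field K] [Algebra (ZMod 2) K]

/-- The group of the maps `x ↦ μ σ(x)`, with `μ ≠ 0` and `σ` a field automorphism. -/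
def semilinearGroup : Subgroup (K ≃ₗ[ZMod 2] K) where
  carrier := {f | ∃ μ : Kˣ, ∃ σ : K ≃ₐ[ZMod 2] K, ∀ x, f x = μ * σ x}
  one_mem' := ⟨1, 1, fun x => by simp⟩
  mul_mem' := by
    rintro f g ⟨μ, σ, hf⟩ ⟨ν, τ, hg⟩
    exact ⟨μ * Units.map σ.toAlgHom.toRingHom.toMonoidHom ν, σ * τ, fun x => by
      simp [hf, hg, mul_assoc]⟩
  inv_mem' := by
    rintro f ⟨μ, σ, hf⟩
    refine ⟨Units.map σ.symm.toAlgHom.toRingHom.toMonoidHom μ⁻¹, σ⁻¹, fun x => ?_⟩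
    apply f.injective
    rw [hf (_ * _)]
    exact (f.apply_symm_apply x).trans (by simp)

variable {K}

theorem exists_mem_semilinearGroup (μ : Kˣ) (σ : K ≃ₐ[ZMod 2] K) :
    ∃ f ∈ semilinearGroup K, ∀ x, f x = μ * σ x :=
  ⟨σ.toLinearEquiv.trans (LinearEquiv.restrictScalars (ZMod 2)
    (DistribMulAction.toModuleAut K K μ)), ⟨μ, σ, fun _ => rfl⟩, fun _ => rfl⟩

theorem card_semilinearGroup [Finite K] : Nat.card (semilinearGroup K) =
    (Nat.card K - 1) * Module.finrank (ZMod 2) K := by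
  choose F hF hF' using exists_mem_semilinearGroup (K := K)
  rw [← Nat.card_units, ← IsGalois.card_aut_eq_finrank, ← Nat.card_prod]
  symm
  refine Nat.card_congr (Equiv.ofBijective (fun p => ⟨F p.1 p.2, hF _ _⟩) ⟨?_, ?_⟩)
  · rintro ⟨μ, σ⟩ ⟨ν, τ⟩ h
    have h1 : ∀ x, (μ : K) * σ x = ν * τ x := fun x => by
      rw [← hF', ← hF']
      exact LinearEquiv.congr_fun (Subtype.ext_iff.1 h) x
    have h2 : μ = ν := Units.ext (by simpa using h1 1)
    subst h2
    exact Prod.ext rfl (AlgEquiv.ext fun x => by simpa using h1 x)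
  · rintro ⟨f, μ, σ, hf⟩
    refine ⟨(μ, σ), Subtype.ext (LinearEquiv.ext fun x => ?_)⟩
    rw [hf]
    exact hF' _ _ _

/-- A field automorphism of prime degree moves every element outside the prime field. -/
theorem algEquiv_eq_one_of_fixes (hp : (Module.finrank (ZMod 2) K).Prime) {σ : K ≃ₐ[ZMod 2] K}
    {c : K} (h0 : c ≠ 0) (h1 : c ≠ 1) (hc : σ c = c) : σ = 1 := by
  have := Subalgebra.isSimpleOrder_of_finrank_prime (ZMod 2) K hp
  rcases eq_bot_or_eq_top (AlgHom.equalizer (σ : K →ₐ[ZMod 2] K) (AlgHom.id _ _)) with h | h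
  · exfalso
    have hc' : c ∈ AlgHom.equalizer (σ : K →ₐ[ZMod 2] K) (AlgHom.id _ _) := hc
    rw [h, Algebra.mem_bot] at hc'
    obtain ⟨z, rfl⟩ := hc'
    fin_cases z
    · exact h0 (map_zero _)
    · exact h1 (map_one _)
  · ext x
    have : x ∈ AlgHom.equalizer (σ : K →ₐ[ZMod 2] K) (AlgHom.id _ _) := h ▸ Algebra.mem_top
    exact this

/-- A semilinear map that fixes a subgroup of order four is the identity: its order is prime to
`4!`, so it fixes the subgroup pointwise, and then it fixes a quotient outside the prime field. -/
theorem eq_one_of_smul_eq [Finite K] (hp : (Module.finrank (ZMod 2) K).Prime)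
    (hco : (Nat.card (semilinearGroup K)).Coprime 24) {f : K ≃ₗ[ZMod 2] K}
    (hf : f ∈ semilinearGroup K) {A : AddSubgroup K} (hA : Nat.card A = 4)
    (hfA : f • A = A) : f = 1 := by
  classical
  have := Fintype.ofFinite A
  have hmap : ∀ a : A, f a ∈ A := fun a => by
    have := AddSubgroup.smul_mem_pointwise_smul a.1 f A a.2
    rwa [hfA] at this
  let e : Equiv.Perm A := Equiv.ofBijective (fun a => ⟨f a, hmap a⟩)
    (Finite.injective_iff_bijective.1 fun a b h =>
      Subtype.ext (f.injective (Subtype.ext_iff.1 h)))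
  have he : ∀ (n : ℕ) (a : A), ((e ^ n) a : K) = (f ^ n) a := by
    intro n
    induction n with
    | zero => simp
    | succ n ih =>
      intro a
      rw [pow_succ, pow_succ, Equiv.Perm.mul_apply, ih]
      rfl
  have h1 : orderOf e ∣ Nat.card (semilinearGroup K) := by
    apply orderOf_dvd_of_pow_eq_one
    have : f ^ Nat.card (semilinearGroup K) = 1 := by
      have := pow_card_eq_one' (x := (⟨f, hf⟩ : semilinearGroup K))
      exact Subtype.ext_iff.1 this
    ext a
    rw [he, this]
    rfl
  have h2 : orderOf e ∣ 24 := by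
    have := orderOf_dvd_card (x := e)
    rwa [Fintype.card_perm, ← Nat.card_eq_fintype_card, hA] at this
  have h3 : e = 1 := orderOf_eq_one_iff.1 (Nat.eq_one_of_dvd_coprimes hco h1 h2)
  have h4 : ∀ a ∈ A, f a = a := fun a ha => by simpa [h3] using (he 1 ⟨a, ha⟩).symm
  obtain ⟨a, ha, b, hb, ha0, hb0, hab⟩ := exists_ne_of_card_eq_four hA
  obtain ⟨μ, σ, hμ⟩ := hf
  have h5 := hμ a ▸ h4 a ha
  have h6 := hμ b ▸ h4 b hb
  have hσ : σ = 1 := by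
    refine algEquiv_eq_one_of_fixes hp (c := a / b) (div_ne_zero ha0 hb0)
      (fun h => hab (by rwa [div_eq_one_iff_eq hb0] at h)) ?_
    rw [map_div₀]
    conv_rhs => rw [← h5, ← h6]
    rw [mul_div_mul_left _ _ μ.ne_zero]
  subst hσ
  have h7 : (μ : K) = 1 := mul_right_cancel₀ ha0 (by simpa using h5)
  ext x
  simp [hμ, h7]

instance : MulAction (semilinearGroup K) {A : AddSubgroup K // Nat.card A = 4} where
  smul f A := ⟨f.1 • A.1, by
    exact (Set.natCard_smul_set f.1 (A.1 : Set K)).trans A.2⟩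
  one_smul A := Subtype.ext (one_smul _ A.1)
  mul_smul f g A := Subtype.ext (mul_smul f.1 g.1 A.1)

/-- The semilinear group acts freely on the subgroups of order four. -/
theorem card_orbits [Finite K] (hp : (Module.finrank (ZMod 2) K).Prime)
    (hco : (Nat.card (semilinearGroup K)).Coprime 24) :
    Nat.card (MulAction.orbitRel.Quotient (semilinearGroup K)
      {A : AddSubgroup K // Nat.card A = 4}) * Module.finrank (ZMod 2) K * 6 = Nat.card K - 2 := by
  have hfree : ∀ A : {A : AddSubgroup K // Nat.card A = 4},
      MulAction.stabilizer (semilinearGroup K) A = ⊥ := by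
    intro A
    rw [eq_bot_iff]
    intro f hf
    exact Subtype.ext (eq_one_of_smul_eq hp hco f.2 A.2 (Subtype.ext_iff.1 hf))
  have := charP_of_injective_algebraMap' (ZMod 2) (A := K) 2
  have h1 := Nat.card_congr (MulAction.selfEquivOrbitsQuotientProd hfree)
  have h2 := card_subgroups_of_card_four (K := K) (fun x => CharTwo.add_self_eq_zero x)
  rw [h1, Nat.card_prod, card_semilinearGroup] at h2
  have h3 : 0 < Nat.card K - 1 := Nat.sub_pos_of_lt Finite.one_lt_card
  refine Nat.eq_of_mul_eq_mul_left h3 ?_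
  rw [← h2]
  ring

end Semilinear

/-! ### Normalisation of the pencil -/

section ArtinSchreier

variable {K : Type*} [Field K] [Finite K] [Algebra (ZMod 2) K]

theorem trace_sq (x : K) : Algebra.trace (ZMod 2) K (x ^ 2) = Algebra.trace (ZMod 2) K x := by
  have := charP_of_injective_algebraMap' (ZMod 2) (A := K) 2
  have h := Algebra.trace_eq_of_algEquiv
    (FiniteField.frobeniusAlgEquivOfAlgebraic (ZMod 2) K) x
  rw [← h]
  simp

/-- Additive Hilbert 90: an element of trace zero has the form `t² + t`. -/
theorem exists_sq_add_eq_of_trace_eq_zero {x : K} (hx : Algebra.trace (ZMod 2) K x = 0) :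
    ∃ t : K, t ^ 2 + t = x := by
  have := charP_of_injective_algebraMap' (ZMod 2) (A := K) 2
  let f : K →ₗ[ZMod 2] K := AddMonoidHom.toZModLinearMap 2
    { toFun := fun t => t ^ 2 + t
      map_zero' := by simp
      map_add' := fun s t => by rw [CharTwo.add_sq]; ring }
  have hf : ∀ t, f t = t ^ 2 + t := fun t => rfl
  have hle : f.range ≤ (Algebra.trace (ZMod 2) K).ker := by
    rintro _ ⟨t, rfl⟩
    rw [LinearMap.mem_ker, hf, map_add, trace_sq, CharTwo.add_self_eq_zero]
  have hker : Module.finrank (ZMod 2) f.ker ≤ 1 := by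
    have : f.ker ≤ Submodule.span (ZMod 2) {1} := by
      intro t ht
      rw [LinearMap.mem_ker, hf] at ht
      have : t * (t + 1) = 0 := by linear_combination ht
      rcases mul_eq_zero.1 this with h | h
      · rw [h]; exact zero_mem _
      · rw [CharTwo.add_eq_zero.1 h]; exact Submodule.mem_span_singleton_self _
    exact (Submodule.finrank_mono this).trans (finrank_span_singleton one_ne_zero).le
  have h1 := LinearMap.finrank_range_add_finrank_ker f
  have h2 := LinearMap.finrank_range_add_finrank_ker (Algebra.trace (ZMod 2) K)
  have h3 : (Algebra.trace (ZMod 2) K).range = ⊤ :=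
    LinearMap.range_eq_top.2 (Algebra.trace_surjective (ZMod 2) K)
  rw [h3, finrank_top, Module.finrank_self] at h2
  have heq := Submodule.eq_of_le_of_finrank_le hle (by omega)
  have : x ∈ f.range := by rw [heq]; exact hx
  exact this

theorem trace_one_of_odd_finrank {K : Type*} [Field K] [Algebra (ZMod 2) K]
    (hodd : Odd (Module.finrank (ZMod 2) K)) : Algebra.trace (ZMod 2) K 1 = 1 := by
  have := Algebra.trace_algebraMap (S := K) (1 : ZMod 2)
  rwa [map_one, nsmul_one, ZMod.natCast_eq_one_iff_odd.2 hodd] at this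

end ArtinSchreier

namespace PG2

open QuadraticAlgebra

theorem perm_smul_eq_iff {X : Type*} {g : Equiv.Perm X} {S T : Set X} :
    g • S = T ↔ ∀ P, g P ∈ T ↔ P ∈ S := by
  constructor
  · rintro rfl P
    exact Set.smul_mem_smul_set_iff (a := g)
  · intro h
    ext P
    rw [Set.mem_smul_set_iff_inv_smul_mem, ← h, Equiv.Perm.smul_def]
    simp

theorem smul_dennistonSet {K : Type*} [Field K] {g : Equiv.Perm (PG2 K)} {α β : K}
    {A : AddSubgroup K} (ho : g origin = origin)
    (hc : ∀ c ∈ A, c ≠ 0 → g • conic α 1 c = conic β 1 c) :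
    g • dennistonSet α A = dennistonSet β A := by
  rw [dennistonSet, dennistonSet, Set.smul_set_union, Set.smul_set_singleton, Set.smul_set_iUnion₂,
    Equiv.Perm.smul_def, ho]
  congr 1
  exact Set.iUnion₂_congr fun c h => hc c h.1 h.2

/-- The shear `(x, y, z) ↦ (x, y + t x, z)`. -/
def shear {K : Type*} [Field K] (t : K) : CubicRootExt K ≃ₗ[K] CubicRootExt K where
  toFun u := ⟨u.re, u.im + t * u.re⟩
  invFun u := ⟨u.re, u.im - t * u.re⟩
  map_add' u v := by ext <;> simp; ring
  map_smul' a u := by ext <;> simp; ring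
  left_inv u := by ext <;> simp
  right_inv u := by ext <;> simp

/-- In odd degree every element `α` of trace one has the form `1 + t + t²`, and the shear with
parameter `t` carries the pencil with `α = 1` to the pencil of `α`. -/
theorem exists_pencil_equiv {K : Type*} [Field K] [Finite K] [Algebra (ZMod 2) K]
    (hodd : Odd (Module.finrank (ZMod 2) K)) {α : K} (hα : Algebra.trace (ZMod 2) K α = 1) :
    ∃ s ∈ collineationGroup K, s origin = origin ∧
      s • (lineAtInfinity : Set (PG2 K)) = lineAtInfinity ∧
      ∀ c, s • conic 1 1 c = conic α 1 c := by
  have := charP_of_injective_algebraMap' (ZMod 2) (A := K) 2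
  have h1 := trace_one_of_odd_finrank hodd
  obtain ⟨t, ht⟩ := exists_sq_add_eq_of_trace_eq_zero (x := α + 1)
    (by rw [map_add, hα, h1]; rfl)
  refine ⟨extend (shear t), extend_mem_collineationGroup _, ?_, ?_, fun c => ?_⟩
  · rw [origin_eq_affinePoint, extend_affinePoint, map_zero]
  · rw [perm_smul_eq_iff]
    intro P
    induction P using Projectivization.ind with
    | h v hv =>
      rw [mem_lineAtInfinity_mk hv]
      exact mem_lineAtInfinity_mk _
  · rw [perm_smul_eq_iff]
    intro P
    induction P using Projectivization.ind with
    | h v hv =>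
      rw [mem_conic_mk hv]
      refine (mem_conic_mk ((extendEquiv (shear t)).map_ne_zero_iff.2 hv)).trans ?_
      have h2 : (2 : K) = 0 := CharTwo.two_eq_zero
      have : α = 1 + t + t ^ 2 := by grind
      refine iff_of_eq (congrArg (· = 0) ?_)
      simp only [extendEquiv, shear, LinearEquiv.coe_mk, LinearMap.coe_mk, AddHom.coe_mk,
        Matrix.cons_val_zero, Matrix.cons_val_one, Matrix.cons_val]
      grind

theorem exists_smul_eq_dennistonSet {K : Type*} [Field K] [Finite K] [Algebra (ZMod 2) K]
    (hodd : Odd (Module.finrank (ZMod 2) K)) {D : Set (PG2 K)} {d : ℕ} (hD : IsDennistonArc d D) :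
    ∃ A : AddSubgroup K, Nat.card A = d ∧ ∃ g ∈ collineationGroup K, D = g • dennistonSet 1 A := by
  obtain ⟨α, A, g, hα, hA, hg, rfl⟩ := hD
  obtain ⟨s, hs, ho, -, hc⟩ := exists_pencil_equiv hodd hα
  exact ⟨A, hA, g * s, mul_mem hg hs, by
    rw [mul_smul, smul_dennistonSet ho fun c _ _ => hc c]⟩

/-! ### Isomorphism classes as orbits of parameter groups -/

section Classification

variable {K : Type*} [Field K] [Finite K] [Algebra (ZMod 2) K]
  [Fact (∀ r : K, r ^ 2 ≠ 1 + 1 * r)]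

/-- A collineation between two arcs induces a semilinear map of their parameter groups, and it is a
rotation or a reflection if that map is the identity. -/
theorem exists_semilinear_of_smul_eq (hq : 16 ≤ Nat.card K) {A B : AddSubgroup K}
    (hA : Nat.card A = 4) (hB : Nat.card B = 4) {M : GL (Fin 3) K} {σ : K ≃+* K}
    {g : Equiv.Perm (PG2 K)} (hg : Induces M σ g) (h : g • dennistonSet 1 B = dennistonSet 1 A) :
    ∃ f ∈ semilinearGroup K, f • B = A ∧
      (f = 1 → ∃ ε ∈ normOneUnits K, g = rotation ε ∨ g = rotation ε * flip K) := by
  have := charP_of_injective_algebraMap' (ZMod 2) (A := K) 2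
  obtain ⟨k, hk, hm, h0, hN, hAB⟩ := matrix_of_dennistonSet_subset hq hg hA hB h.ge
  let σ' : K ≃ₐ[ZMod 2] K := AlgEquiv.ofRingEquiv (f := σ)
    fun r => RingHom.congr_fun (Subsingleton.elim (σ.toRingHom.comp (algebraMap (ZMod 2) K)) _) r
  obtain ⟨f, hf, hfx⟩ := exists_mem_semilinearGroup
    (Units.mk0 (k / M.val 2 2 ^ 2) (div_ne_zero hk (pow_ne_zero 2 hm))) σ'
  have hfx' : ∀ x, f x = k / M.val 2 2 ^ 2 * σ x := hfx
  refine ⟨f, hf, ?_, ?_⟩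
  · symm
    refine AddSubgroup.eq_of_le_of_card_ge ?_ ?_
    · intro a ha
      obtain ⟨b, hb, e⟩ := hAB a ha
      have : a = f • b := by
        change a = f b
        rw [hfx']
        field_simp
        exact e
      rw [this]
      exact AddSubgroup.smul_mem_pointwise_smul b f B hb
    · rw [hA, ← hB]
      exact (Set.natCard_smul_set f (B : Set K)).le
  · rintro rfl
    have h1 : k / M.val 2 2 ^ 2 = 1 := by simpa using (hfx' 1).symm
    have h2 : σ = RingEquiv.refl K := by
      ext x
      simpa [h1] using (hfx' x).symm
    subst h2
    have h3 : k = M.val 2 2 ^ 2 := (div_eq_one_iff_eq (pow_ne_zero 2 hm)).1 h1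
    exact eq_rotation_or_rotation_mul_flip hg hm h0 (h3 ▸ hN)

/-- Semilinearly equivalent parameter groups belong to isomorphic arcs. -/
theorem exists_collineation_of_semilinear {f : K ≃ₗ[ZMod 2] K} (hf : f ∈ semilinearGroup K)
    (B : AddSubgroup K) :
    ∃ g ∈ collineationGroup K, g • dennistonSet 1 B = dennistonSet 1 (f • B) := by
  have := charP_of_injective_algebraMap' (ZMod 2) (A := K) 2
  obtain ⟨μ, σ, hf⟩ := hf
  -- `diag (1, 1, ν)` divides the norm form of the affine part by `ν²`, so `ν² = μ⁻¹` is needed.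
  obtain ⟨ν, hν⟩ := exists_sq_eq (μ : K)⁻¹
  have hν0 : ν ≠ 0 := by
    rintro rfl
    exact inv_ne_zero μ.ne_zero (by rw [← hν]; simp)
  obtain ⟨g, hg, hgi⟩ := exists_induces (Matrix.GeneralLinearGroup.mkOfDetNeZero
    (Matrix.diagonal ![1, 1, ν]) (by simp [Matrix.det_diagonal, Fin.prod_univ_three, hν0]))
    (σ : K ≃+* K)
  refine ⟨g, hg, perm_smul_eq_iff.2 fun P => ?_⟩
  have hvec : ∀ v : Fin 3 → K, (Matrix.diagonal ![1, 1, ν]).mulVec (fun i => (σ : K ≃+* K) (v i)) =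
      ![σ (v 0), σ (v 1), ν * σ (v 2)] := by
    intro v
    funext i
    fin_cases i <;> simp [Matrix.mulVec_diagonal]
  rcases eq_affinePoint_or_infPoint P with ⟨u, rfl⟩ | ⟨u, hu, rfl⟩
  · have h1 : g (affinePoint u) = affinePoint ⟨σ u.re / ν, σ u.im / ν⟩ := by
      obtain ⟨hw, e⟩ := hgi ![u.re, u.im, 1] (fun h => one_ne_zero (congrFun h 2))
      rw [affinePoint, e, affinePoint, Projectivization.mk_eq_mk_iff']
      refine ⟨ν, ((hvec _).trans ?_).symm⟩
      funext i
      fin_cases i <;> simp [mul_div_cancel₀, hν0]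
    have h2 : norm (⟨σ u.re / ν, σ u.im / ν⟩ : CubicRootExt K) = f (norm u) := by
      rw [norm_eq_sq_add_mul_add_sq, norm_eq_sq_add_mul_add_sq, hf,
        show (μ : K) = (ν ^ 2)⁻¹ by rw [hν, inv_inv]]
      simp only [map_add, map_mul, map_pow]
      field_simp
    rw [h1, affinePoint_mem_dennistonSet, affinePoint_mem_dennistonSet, h2]
    exact AddSubgroup.smul_mem_pointwise_smul_iff (a := f)
  · have h1 : ∃ w hw, g (infPoint u hu) = infPoint w hw := by
      obtain ⟨hw, e⟩ := hgi ![u.re, u.im, 0] (infPoint_ne_zero hu)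
      have := hvec ![u.re, u.im, 0]
      refine mem_lineAtInfinity_iff.1 ?_
      rw [infPoint, e, mem_lineAtInfinity_mk]
      exact (congrFun this 2).trans (by simp)
    obtain ⟨w, hw, e⟩ := h1
    have h3 : ∀ (w : CubicRootExt K) (hw : w ≠ 0) (A : AddSubgroup K),
        infPoint w hw ∉ dennistonSet 1 A := fun w hw A h => by
      obtain ⟨v, h, -⟩ := mem_dennistonSet_iff.1 h
      exact affinePoint_ne_infPoint v hw h.symm
    rw [e]
    exact iff_of_false (h3 _ _ _) (h3 _ _ _)

/-- The isomorphism classes of arcs are the orbits of the semilinear group on the parameter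
groups. -/
theorem card_dennistonClass (hq : 16 ≤ Nat.card K) (hodd : Odd (Module.finrank (ZMod 2) K)) :
    Nat.card (DennistonClass K 4) = Nat.card
      (MulAction.orbitRel.Quotient (semilinearGroup K) {A : AddSubgroup K // Nat.card A = 4}) := by
  have htr := trace_one_of_odd_finrank hodd
  let F : {A : AddSubgroup K // Nat.card A = 4} → {D : Set (PG2 K) // IsDennistonArc 4 D} :=
    fun A => ⟨dennistonSet 1 A.1, 1, A.1, 1, htr, A.2, one_mem _, (one_smul _ _).symm⟩
  have hF : ∀ A B, (dennistonSetoid K 4) (F A) (F B) ↔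
      (MulAction.orbitRel (semilinearGroup K) _) A B := by
    intro A B
    rw [← Setoid.comm' (MulAction.orbitRel (semilinearGroup K) _), MulAction.orbitRel_apply]
    constructor
    · rintro ⟨g, ⟨M, σ, hg⟩, h⟩
      obtain ⟨f, hf, hfB, -⟩ := exists_semilinear_of_smul_eq hq B.2 A.2 hg h
      exact ⟨⟨f, hf⟩, Subtype.ext hfB⟩
    · rintro ⟨⟨f, hf⟩, h⟩
      obtain ⟨g, hg, e⟩ := exists_collineation_of_semilinear hf A.1
      exact ⟨g, hg, e.trans (congrArg (dennistonSet 1) (Subtype.ext_iff.1 h))⟩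
  symm
  refine Nat.card_congr (Equiv.ofBijective
    (Quotient.map F fun A B h => (hF A B).2 h) ⟨?_, ?_⟩)
  · rintro ⟨A⟩ ⟨B⟩ h
    exact Quotient.sound ((hF A B).1 (Quotient.exact h))
  · rintro ⟨⟨D, hD⟩⟩
    obtain ⟨A, hA, g, hg, rfl⟩ := exists_smul_eq_dennistonSet hodd hD
    exact ⟨⟦⟨A, hA⟩⟧, Quotient.sound ⟨g, hg, rfl⟩⟩

end Classification

end PG2

/-! ### Semidirect products with a cyclic subgroup of index two -/

/-- A group with a cyclic subgroup of order `n` and index two, and an involution outside it, is a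
semidirect product. -/
theorem exists_mulEquiv_semidirectProduct {G : Type*} [Group G] {n : ℕ} [NeZero n]
    {H C : Subgroup G} (hCH : C ≤ H) [IsCyclic C] (hC : Nat.card C = n) (hH : Nat.card H = 2 * n)
    {s : G} (hsH : s ∈ H) (hsC : s ∉ C) (hs : s ^ 2 = 1) :
    ∃ φ : Multiplicative (ZMod 2) →* MulAut (Multiplicative (ZMod n)),
      Nonempty (H ≃* Multiplicative (ZMod n) ⋊[φ] Multiplicative (ZMod 2)) := by
  have hn : 0 < n := Nat.pos_of_ne_zero (NeZero.ne n)
  have : Finite H := Nat.finite_of_card_ne_zero (by omega)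
  let C' := C.subgroupOf H
  let t : H := ⟨s, hsH⟩
  have eC : C' ≃* C := Subgroup.subgroupOfEquivOfLe hCH
  have hC' : Nat.card C' = n := (Nat.card_congr eC.toEquiv).trans hC
  have : IsCyclic C' := isCyclic_of_surjective eC.symm eC.symm.surjective
  have htC : t ∉ C' := hsC
  have ht : orderOf t = 2 :=
    orderOf_eq_prime (Subtype.ext hs) (fun h => htC (h ▸ C'.one_mem))
  have hZ : Nat.card (Subgroup.zpowers t) = 2 := by rw [Nat.card_zpowers, ht]
  have hnormal : C'.Normal := Subgroup.normal_of_index_eq_two (by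
    have := C'.card_mul_index
    rw [hC', hH, mul_comm] at this
    exact Nat.eq_of_mul_eq_mul_right hn this)
  have hcompl : C'.IsComplement' (Subgroup.zpowers t) := by
    refine Subgroup.isComplement'_of_card_mul_and_disjoint (by rw [hC', hZ, hH, mul_comm]) ?_
    rw [Subgroup.disjoint_def]
    intro x hx hxt
    obtain ⟨k, rfl⟩ := Subgroup.mem_zpowers_iff.1 hxt
    have h2 : t ^ (2 : ℤ) = 1 := by exact_mod_cast (orderOf_dvd_iff_pow_eq_one.1 ht.dvd)
    rcases Int.even_or_odd' k with ⟨j, rfl | rfl⟩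
    · rw [zpow_mul, h2, one_zpow]
    · rw [zpow_add, zpow_mul, h2, one_zpow, one_mul, zpow_one] at hx
      exact absurd hx htC
  have : IsCyclic (Subgroup.zpowers t) := inferInstance
  let e1 : C' ≃* Multiplicative (ZMod n) := (hC' ▸ zmodCyclicMulEquiv (G := C') inferInstance).symm
  let e2 : Subgroup.zpowers t ≃* Multiplicative (ZMod 2) :=
    (hZ ▸ zmodCyclicMulEquiv (G := Subgroup.zpowers t) inferInstance).symm
  exact ⟨_, ⟨(SemidirectProduct.mulEquivSubgroup hcompl).symm.trans
    (SemidirectProduct.congr' e1 e2)⟩⟩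

namespace PG2

open QuadraticAlgebra

theorem autGroup_smul {K : Type*} [Field K] {g : Equiv.Perm (PG2 K)} (hg : g ∈ collineationGroup K)
    (D : Set (PG2 K)) : autGroup (g • D) = (autGroup D).map (MulAut.conj g).toMonoidHom := by
  ext e
  rw [Subgroup.mem_map_equiv, MulAut.conj_symm_apply, autGroup, autGroup, Subgroup.mem_inf,
    Subgroup.mem_inf, MulAction.mem_stabilizer_iff, MulAction.mem_stabilizer_iff, mul_smul,
    mul_smul, inv_smul_eq_iff, Subgroup.mul_mem_cancel_right _ hg,
    Subgroup.mul_mem_cancel_left _ (inv_mem hg)]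

theorem mem_autGroup_of_forall_conic {K : Type*} [Field K] {e : Equiv.Perm (PG2 K)}
    {A : AddSubgroup K} (he : e ∈ collineationGroup K) (ho : e origin = origin)
    (hc : ∀ c ∈ A, c ≠ 0 → e • conic 1 1 c = conic 1 1 c) : e ∈ autGroup (dennistonSet 1 A) :=
  ⟨he, smul_dennistonSet ho hc⟩

/-! ### Rotations, reflections and their axes -/

section Reflections

variable {K : Type*} [Field K]

/-- The reflection `[u, z] ↦ [ε ū, z]` of the plane. -/
def reflection (ε : (CubicRootExt K)ˣ) : Equiv.Perm (PG2 K) := rotation ε * flip K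

theorem reflection_affinePoint (ε : (CubicRootExt K)ˣ) (u : CubicRootExt K) :
    reflection ε (affinePoint u) = affinePoint ((ε : CubicRootExt K) * star u) := rfl

theorem reflection_infPoint (ε : (CubicRootExt K)ˣ) {u : CubicRootExt K} (hu : u ≠ 0) :
    reflection ε (infPoint u hu) = infPoint ((ε : CubicRootExt K) * star u)
      (ε.mul_right_eq_zero.not.2 (star_ne_zero.2 hu)) := rfl

theorem rotation_mem_collineationGroup (ε : (CubicRootExt K)ˣ) :
    rotation ε ∈ collineationGroup K := extend_mem_collineationGroup _

theorem reflection_mem_collineationGroup (ε : (CubicRootExt K)ˣ) :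
    reflection ε ∈ collineationGroup K :=
  mul_mem (rotation_mem_collineationGroup ε) (extend_mem_collineationGroup _)

theorem rotation_injective : Function.Injective (rotation (K := K)) := by
  intro ε ε' h
  have := congrFun (congrArg DFunLike.coe h) (affinePoint 1)
  rw [rotation_affinePoint, rotation_affinePoint] at this
  exact Units.ext (by simpa using affinePoint_injective this)

theorem reflection_injective : Function.Injective (reflection (K := K)) := fun _ _ h =>
  rotation_injective (mul_right_cancel h)

theorem rotation_ne_reflection (ε ε' : (CubicRootExt K)ˣ) : rotation ε ≠ reflection ε' := by
  intro h
  have h1 := congrFun (congrArg DFunLike.coe h) (affinePoint 1)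
  have h2 := congrFun (congrArg DFunLike.coe h) (affinePoint ⟨0, 1⟩)
  rw [rotation_affinePoint, reflection_affinePoint] at h1 h2
  have h3 := affinePoint_injective h1
  have h4 := affinePoint_injective h2
  rw [star_one, mul_one, mul_one] at h3
  rw [h3] at h4
  have h5 := congrArg re (ε'.mul_right_inj.1 h4)
  simp at h5

theorem affinePoint_notMem_lineAtInfinity (u : CubicRootExt K) :
    affinePoint u ∉ (lineAtInfinity : Set (PG2 K)) := fun h => by
  obtain ⟨v, hv, e⟩ := mem_lineAtInfinity_iff.1 h
  exact affinePoint_ne_infPoint _ hv e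

/-- The line joining the nucleus to the point `η` at infinity; its equation is
`η.im * x - η.re * y = 0`. -/
def axis (η : CubicRootExt K) (hη : η ≠ 0) : Set (PG2 K) :=
  line (Projectivization.mk K ![η.im, -η.re, 0] (fun h => hη (QuadraticAlgebra.ext
    (neg_eq_zero.1 (congrFun h 1)) (congrFun h 0))))

theorem im_mul_sub_re_mul_eq_zero_iff {η u : CubicRootExt K} (hη : η ≠ 0) :
    η.im * u.re - η.re * u.im = 0 ↔ ∃ k : K, k • η = u := by
  constructor
  · intro h
    by_cases h0 : η.re = 0
    · have h1 : η.im ≠ 0 := fun h1 => hη (QuadraticAlgebra.ext h0 h1)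
      refine ⟨u.im / η.im, ?_⟩
      rw [h0, zero_mul, sub_zero] at h
      ext
      · simp [h0, (mul_eq_zero.1 h).resolve_left h1]
      · simp [h1]
    · refine ⟨u.re / η.re, ?_⟩
      ext
      · simp [h0]
      · simp only [im_smul, smul_eq_mul]
        field_simp
        linear_combination h
  · rintro ⟨k, rfl⟩
    simp only [re_smul, im_smul, smul_eq_mul]
    ring

theorem affinePoint_mem_axis {η u : CubicRootExt K} (hη : η ≠ 0) :
    affinePoint u ∈ axis η hη ↔ ∃ k : K, k • η = u := by
  rw [affinePoint, axis, mem_line_mk, ← im_mul_sub_re_mul_eq_zero_iff hη]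
  simp [sub_eq_add_neg]

theorem infPoint_mem_axis {η u : CubicRootExt K} (hη : η ≠ 0) (hu : u ≠ 0) :
    infPoint u hu ∈ axis η hη ↔ ∃ k : K, k • η = u := by
  rw [infPoint, axis, mem_line_mk, ← im_mul_sub_re_mul_eq_zero_iff hη]
  simp [sub_eq_add_neg]

theorem isLine_axis {η : CubicRootExt K} (hη : η ≠ 0) : IsLine (axis η hη) := ⟨_, rfl⟩

theorem origin_mem_axis {η : CubicRootExt K} (hη : η ≠ 0) : origin ∈ axis η hη := by
  rw [origin_eq_affinePoint, affinePoint_mem_axis]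
  exact ⟨0, zero_smul _ _⟩

theorem exists_eq_axis {l : Set (PG2 K)} (hl : IsLine l) (ho : origin ∈ l) :
    ∃ η hη, l = axis η hη := by
  obtain ⟨a, rfl⟩ := hl
  induction a using Projectivization.ind with
  | h a ha =>
    rw [origin, mem_line_mk] at ho
    have h2 : a 2 = 0 := by simpa using ho
    refine ⟨⟨-a 1, a 0⟩, fun h => ha ?_, ?_⟩
    · funext i
      fin_cases i
      · exact congrArg im h
      · exact neg_eq_zero.1 (congrArg re h)
      · exact h2
    · rw [axis]
      congr 2
      funext i
      fin_cases i <;> simp [h2]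

theorem reflection_mul_self {ε : (CubicRootExt K)ˣ} (hε : ε ∈ normOneUnits K) :
    reflection ε * reflection ε = 1 := by
  have h : (ε : CubicRootExt K) * star (ε : CubicRootExt K) = 1 := by
    rw [← algebraMap_norm_eq_mul_star, mem_normOneUnits.1 hε, map_one]
  have h' : ∀ u : CubicRootExt K,
      (ε : CubicRootExt K) * star ((ε : CubicRootExt K) * star u) = u := by
    intro u
    rw [star_mul, star_star, mul_left_comm, h, mul_one]
  ext P
  rcases eq_affinePoint_or_infPoint P with ⟨u, rfl⟩ | ⟨u, hu, rfl⟩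
  · rw [Equiv.Perm.mul_apply, reflection_affinePoint, reflection_affinePoint, h']
    rfl
  · rw [Equiv.Perm.mul_apply, reflection_infPoint, reflection_infPoint]
    simp only [h']
    rfl

theorem rotation_smul_lineAtInfinity (ε : (CubicRootExt K)ˣ) :
    rotation ε • (lineAtInfinity : Set (PG2 K)) = lineAtInfinity := by
  rw [perm_smul_eq_iff]
  intro P
  rcases eq_affinePoint_or_infPoint P with ⟨u, rfl⟩ | ⟨u, hu, rfl⟩
  · exact iff_of_false (affinePoint_notMem_lineAtInfinity _) (affinePoint_notMem_lineAtInfinity _)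
  · rw [rotation_infPoint]
    exact iff_of_true (mem_lineAtInfinity_iff.2 ⟨_, _, rfl⟩) (mem_lineAtInfinity_iff.2 ⟨_, _, rfl⟩)

theorem rotation_origin (ε : (CubicRootExt K)ˣ) : rotation ε origin = origin := by
  rw [origin_eq_affinePoint, rotation_affinePoint, mul_zero]

theorem reflection_origin (ε : (CubicRootExt K)ˣ) : reflection ε origin = origin := by
  rw [origin_eq_affinePoint, reflection_affinePoint, star_zero, mul_zero]

theorem isCyclic_map_normOneUnits [Finite K]
    [Fact (∀ r : K, r ^ 2 ≠ 1 + 1 * r)] {G : Type*} [Group G] {φ : (CubicRootExt K)ˣ →* G}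
    (hφ : Function.Injective φ) : IsCyclic ((normOneUnits K).map φ) := by
  have e := (normOneUnits K).equivMapOfInjective φ hφ
  exact isCyclic_of_surjective e e.surjective

theorem exists_unit_of_mul_star_eq [Fact (∀ r : K, r ^ 2 ≠ 1 + 1 * r)]
    {η : CubicRootExt K} (hη : η ≠ 0) :
    ∃ ε ∈ normOneUnits K, (ε : CubicRootExt K) * star η = η :=
  exists_unit_mul_eq_of_norm_eq (star_ne_zero.2 hη) (QuadraticAlgebra.norm_star η)

/-- A nontrivial rotation fixes no affine point except the nucleus, so it is not an elation with
axis through the nucleus. -/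
theorem not_isElation_rotation [Fact (∀ r : K, r ^ 2 ≠ 1 + 1 * r)]
    {ε : (CubicRootExt K)ˣ} {l : Set (PG2 K)} {z : PG2 K}
    (ho : origin ∈ l) : ¬ IsElation (rotation ε) z l := by
  intro h
  obtain ⟨η, hη, rfl⟩ := exists_eq_axis h.isLine ho
  have h1 := h.fix_axis (affinePoint η) ((affinePoint_mem_axis hη).2 ⟨1, one_smul _ _⟩)
  rw [rotation_affinePoint] at h1
  have h2 : ε = 1 := Units.ext (mul_right_cancel₀ hη
    ((affinePoint_injective h1).trans (one_mul η).symm))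
  exact h.ne_one (by rw [h2, map_one])

variable [CharP K 2] [Fact (∀ r : K, r ^ 2 ≠ 1 + 1 * r)]

/-- The difference of a point and its mirror image has the direction `η`. -/
theorem exists_mul_star_eq_add_smul {ε η : CubicRootExt K} (hη : η ≠ 0) (h : ε * star η = η)
    (u : CubicRootExt K) : ∃ k : K, ε * star u = u + k • η := by
  refine ⟨trace (u * star η) / norm η, ?_⟩
  have hη' : star η ≠ 0 := star_ne_zero.2 hη
  have hN : algebraMap K (CubicRootExt K) (norm η) ≠ 0 := by
    rw [Ne, map_eq_zero]; exact norm_ne_zero hη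
  have h2 : (2 : CubicRootExt K) = 0 := CharTwo.two_eq_zero
  rw [Algebra.smul_def, map_div₀, algebraMap_trace_eq_add_star, algebraMap_norm_eq_mul_star,
    star_mul, star_star]
  field_simp
  linear_combination star u * h - u * star η * h2

theorem isElation_reflection {ε : (CubicRootExt K)ˣ} {η : CubicRootExt K} (hη : η ≠ 0)
    (h : (ε : CubicRootExt K) * star η = η) :
    IsElation (reflection ε) (infPoint η hη) (axis η hη) where
  mem_collineationGroup := reflection_mem_collineationGroup ε
  ne_one h := rotation_ne_reflection 1 ε (by rw [h, map_one])
  isLine := isLine_axis hη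
  center_mem := (infPoint_mem_axis hη hη).2 ⟨1, one_smul _ _⟩
  fix_axis P hP := by
    have h' : ∀ k : K, (ε : CubicRootExt K) * star (k • η) = k • η := fun k => by
      have : star (k • η) = k • star η := (starEquiv K).map_smul k η
      rw [this, mul_smul_comm, h]
    rcases eq_affinePoint_or_infPoint P with ⟨u, rfl⟩ | ⟨u, hu, rfl⟩
    · obtain ⟨k, rfl⟩ := (affinePoint_mem_axis hη).1 hP
      rw [reflection_affinePoint, h']
    · obtain ⟨k, rfl⟩ := (infPoint_mem_axis hη hu).1 hP
      simp only [reflection_infPoint, h']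
  fix_center m hm hc := by
    obtain ⟨a, rfl⟩ := hm
    rw [perm_smul_eq_iff]
    intro P
    induction a using Projectivization.ind with
    | h a ha =>
      rw [infPoint, mem_line_mk] at hc
      have hc' : a 0 * η.re + a 1 * η.im = 0 := by simpa using hc
      rcases eq_affinePoint_or_infPoint P with ⟨u, rfl⟩ | ⟨u, hu, rfl⟩
      · obtain ⟨k, hk⟩ := exists_mul_star_eq_add_smul hη h u
        rw [reflection_affinePoint, hk, affinePoint, affinePoint, mem_line_mk, mem_line_mk]
        refine iff_of_eq (congrArg (· = 0) ?_)
        simp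
        linear_combination k * hc'
      · obtain ⟨k, hk⟩ := exists_mul_star_eq_add_smul hη h u
        simp only [reflection_infPoint, hk]
        rw [infPoint, infPoint, mem_line_mk, mem_line_mk]
        refine iff_of_eq (congrArg (· = 0) ?_)
        simp
        linear_combination k * hc'

/-- Each rotation or reflection of norm one preserves the norm form, hence each conic. -/
theorem rotation_smul_conic {ε : (CubicRootExt K)ˣ} (hε : ε ∈ normOneUnits K) (c : K) :
    rotation ε • conic 1 1 c = conic 1 1 c := by
  rw [perm_smul_eq_iff]
  intro P
  rcases eq_affinePoint_or_infPoint P with ⟨u, rfl⟩ | ⟨u, hu, rfl⟩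
  · rw [rotation_affinePoint, affinePoint_mem_conic, affinePoint_mem_conic, map_mul,
      mem_normOneUnits.1 hε, one_mul]
  · rw [rotation_infPoint]
    exact iff_of_false (infPoint_notMem_conic _ c) (infPoint_notMem_conic _ c)

theorem reflection_smul_conic {ε : (CubicRootExt K)ˣ} (hε : ε ∈ normOneUnits K) (c : K) :
    reflection ε • conic 1 1 c = conic 1 1 c := by
  rw [perm_smul_eq_iff]
  intro P
  rcases eq_affinePoint_or_infPoint P with ⟨u, rfl⟩ | ⟨u, hu, rfl⟩
  · rw [reflection_affinePoint, affinePoint_mem_conic, affinePoint_mem_conic, map_mul,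
      mem_normOneUnits.1 hε, one_mul, QuadraticAlgebra.norm_star]
  · rw [reflection_infPoint]
    exact iff_of_false (infPoint_notMem_conic _ c) (infPoint_notMem_conic _ c)

theorem existsUnique_rotation_conic {c : K} (hc : c ≠ 0) {P Q : PG2 K} (hP : P ∈ conic 1 1 c)
    (hQ : Q ∈ conic 1 1 c) : ∃! ε, ε ∈ normOneUnits K ∧ rotation ε P = Q := by
  obtain ⟨u, rfl, hu⟩ := mem_conic_iff.1 hP
  obtain ⟨v, rfl, hv⟩ := mem_conic_iff.1 hQ
  have hu0 : u ≠ 0 := by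
    rintro rfl
    exact hc (by rw [← hu, QuadraticAlgebra.norm_zero])
  obtain ⟨ε, hε, h⟩ := exists_unit_mul_eq_of_norm_eq hu0 (hu.trans hv.symm)
  refine ⟨ε, ⟨hε, by rw [rotation_affinePoint, h]⟩, fun ε' h' => ?_⟩
  have h1 := affinePoint_injective ((rotation_affinePoint ε' u).symm.trans h'.2)
  exact Units.ext (mul_right_cancel₀ hu0 (h1.trans h.symm))

theorem existsUnique_rotation_lineAtInfinity [Finite K] {P Q : PG2 K}
    (hP : P ∈ (lineAtInfinity : Set (PG2 K))) (hQ : Q ∈ (lineAtInfinity : Set (PG2 K))) :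
    ∃! ε, ε ∈ normOneUnits K ∧ rotation ε P = Q := by
  obtain ⟨u, hu, rfl⟩ := mem_lineAtInfinity_iff.1 hP
  obtain ⟨v, hv, rfl⟩ := mem_lineAtInfinity_iff.1 hQ
  have norm_smul : ∀ (k : K) (w : CubicRootExt K), norm (k • w) = k ^ 2 * norm w := fun k w => by
    rw [Algebra.smul_def, map_mul, QuadraticAlgebra.norm_algebraMap]
  -- The multiple `k • v` represents the same point at infinity and has the norm of `u`.
  obtain ⟨k, hk⟩ := exists_sq_eq (norm u / norm v)
  have hkn : norm u = norm (k • v) := by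
    rw [norm_smul, hk, div_mul_cancel₀ _ (norm_ne_zero hv)]
  obtain ⟨ε, hε, h⟩ := exists_unit_mul_eq_of_norm_eq hu hkn
  refine ⟨ε, ⟨hε, ?_⟩, fun ε' h' => ?_⟩
  · rw [rotation_infPoint, infPoint_eq_iff]
    exact ⟨k, h.symm⟩
  · obtain ⟨hε', e⟩ := h'
    rw [rotation_infPoint, infPoint_eq_iff] at e
    obtain ⟨k', hk'⟩ := e
    have h1 : norm u = norm (k' • v) := by rw [hk', map_mul, mem_normOneUnits.1 hε', one_mul]
    have h2 : k ^ 2 = k' ^ 2 := by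
      rw [hkn, norm_smul, norm_smul] at h1
      exact mul_right_cancel₀ (norm_ne_zero hv) h1
    have h3 : k = k' := CharTwo.sq_injective h2
    subst h3
    exact Units.ext (mul_right_cancel₀ hu (hk'.symm.trans h.symm))

theorem card_map_normOneUnits [Finite K] {G : Type*} [Group G] {φ : (CubicRootExt K)ˣ →* G}
    (hφ : Function.Injective φ) : Nat.card ((normOneUnits K).map φ) = Nat.card K + 1 := by
  rw [← card_normOneUnits]
  exact (Nat.card_congr ((normOneUnits K).equivMapOfInjective φ hφ).toEquiv).symm

end Reflections

end PG2

namespace PG2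

open QuadraticAlgebra

/-! ### Rotations and reflections as automorphisms of an arc -/

section Automorphisms

variable {K : Type*} [Field K] [Finite K] [Algebra (ZMod 2) K]
  [Fact (∀ r : K, r ^ 2 ≠ 1 + 1 * r)]

theorem mem_autGroup_dennistonSet (hq : 16 ≤ Nat.card K)
    (hp : (Module.finrank (ZMod 2) K).Prime) (hco : (Nat.card (semilinearGroup K)).Coprime 24)
    {A : AddSubgroup K} (hA : Nat.card A = 4) {e : Equiv.Perm (PG2 K)} :
    e ∈ autGroup (dennistonSet 1 A) ↔
      ∃ ε ∈ normOneUnits K, e = rotation ε ∨ e = reflection ε := by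
  have := charP_of_injective_algebraMap' (ZMod 2) (A := K) 2
  constructor
  · rintro ⟨⟨M, σ, hM⟩, h⟩
    obtain ⟨f, hf, hfA, h1⟩ := exists_semilinear_of_smul_eq hq hA hA hM h
    exact h1 (eq_one_of_smul_eq hp hco hf hA hfA)
  · rintro ⟨ε, hε, rfl | rfl⟩
    · exact mem_autGroup_of_forall_conic (rotation_mem_collineationGroup ε) (rotation_origin ε)
        fun c _ _ => rotation_smul_conic hε c
    · exact mem_autGroup_of_forall_conic (reflection_mem_collineationGroup ε) (reflection_origin ε)
        fun c _ _ => reflection_smul_conic hε c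

theorem card_autGroup_dennistonSet (hq : 16 ≤ Nat.card K)
    (hp : (Module.finrank (ZMod 2) K).Prime) (hco : (Nat.card (semilinearGroup K)).Coprime 24)
    {A : AddSubgroup K} (hA : Nat.card A = 4) :
    Nat.card (autGroup (dennistonSet 1 A)) = 2 * (Nat.card K + 1) := by
  have := charP_of_injective_algebraMap' (ZMod 2) (A := K) 2
  have h : (autGroup (dennistonSet 1 A) : Set (Equiv.Perm (PG2 K))) =
      rotation '' normOneUnits K ∪ reflection '' normOneUnits K := by
    ext e
    rw [SetLike.mem_coe, mem_autGroup_dennistonSet hq hp hco hA]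
    constructor
    · rintro ⟨ε, hε, rfl | rfl⟩
      · exact Or.inl ⟨ε, hε, rfl⟩
      · exact Or.inr ⟨ε, hε, rfl⟩
    · rintro (⟨ε, hε, rfl⟩ | ⟨ε, hε, rfl⟩)
      · exact ⟨ε, hε, Or.inl rfl⟩
      · exact ⟨ε, hε, Or.inr rfl⟩
  have hE : (normOneUnits K : Set (CubicRootExt K)ˣ).ncard = Nat.card K + 1 :=
    (Nat.card_coe_set_eq _).symm.trans card_normOneUnits
  change Nat.card (autGroup (dennistonSet 1 A) : Set (Equiv.Perm (PG2 K))) = _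
  rw [h, Nat.card_coe_set_eq, Set.ncard_union_eq ?_ ?_ ?_,
    Set.ncard_image_of_injective _ rotation_injective,
    Set.ncard_image_of_injective _ reflection_injective, hE, two_mul]
  · rw [Set.disjoint_left]
    rintro _ ⟨ε, -, rfl⟩ ⟨ε', -, h⟩
    exact rotation_ne_reflection ε ε' h.symm
  · exact (Set.toFinite _).image _
  · exact (Set.toFinite _).image _

theorem exists_autGroup_mulEquiv (hq : 16 ≤ Nat.card K)
    (hp : (Module.finrank (ZMod 2) K).Prime) (hco : (Nat.card (semilinearGroup K)).Coprime 24)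
    {A : AddSubgroup K} (hA : Nat.card A = 4) :
    ∃ φ : Multiplicative (ZMod 2) →* MulAut (Multiplicative (ZMod (Nat.card K + 1))),
      Nonempty (autGroup (dennistonSet 1 A) ≃*
        Multiplicative (ZMod (Nat.card K + 1)) ⋊[φ] Multiplicative (ZMod 2)) := by
  have := charP_of_injective_algebraMap' (ZMod 2) (A := K) 2
  have := isCyclic_map_normOneUnits (K := K) rotation_injective
  refine exists_mulEquiv_semidirectProduct (C := (normOneUnits K).map rotation) ?_
    (card_map_normOneUnits rotation_injective) (card_autGroup_dennistonSet hq hp hco hA)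
    (s := reflection 1) ((mem_autGroup_dennistonSet hq hp hco hA).2
      ⟨1, one_mem _, Or.inr rfl⟩) ?_ ?_
  · rintro _ ⟨ε, hε, rfl⟩
    exact (mem_autGroup_dennistonSet hq hp hco hA).2 ⟨ε, hε, Or.inl rfl⟩
  · rintro ⟨ε, -, h⟩
    exact rotation_ne_reflection ε 1 h
  · rw [sq, reflection_mul_self (one_mem _)]

/-- The rotations have odd order, so the involutions are the reflections. -/
theorem mem_autGroup_and_orderOf_eq_two_iff (hq : 16 ≤ Nat.card K)
    (hp : (Module.finrank (ZMod 2) K).Prime) (hco : (Nat.card (semilinearGroup K)).Coprime 24)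
    {A : AddSubgroup K} (hA : Nat.card A = 4) {e : Equiv.Perm (PG2 K)} :
    (e ∈ autGroup (dennistonSet 1 A) ∧ orderOf e = 2) ↔
      ∃ ε ∈ normOneUnits K, e = reflection ε := by
  have := charP_of_injective_algebraMap' (ZMod 2) (A := K) 2
  rw [mem_autGroup_dennistonSet hq hp hco hA]
  constructor
  · rintro ⟨⟨ε, hε, rfl | rfl⟩, h⟩
    · exfalso
      rw [orderOf_injective _ rotation_injective] at h
      have h1 : ε ^ 2 = 1 := h ▸ pow_orderOf_eq_one ε
      have h2 : (ε : CubicRootExt K) = 1 := by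
        apply CharTwo.sq_injective
        simpa using congrArg Units.val h1
      rw [Units.ext (h2.trans Units.val_one.symm), orderOf_one] at h
      omega
    · exact ⟨ε, hε, rfl⟩
  · rintro ⟨ε, hε, rfl⟩
    refine ⟨⟨ε, hε, Or.inr rfl⟩, orderOf_eq_prime ?_ fun h => ?_⟩
    · rw [sq, reflection_mul_self hε]
    · exact rotation_ne_reflection 1 ε (by rw [h, map_one])

theorem exists_isElation_reflection {ε : (CubicRootExt K)ˣ} (hε : ε ∈ normOneUnits K) :
    ∃ (l : Set (PG2 K)) (z : PG2 K), origin ∈ l ∧ z ∈ (lineAtInfinity : Set (PG2 K)) ∧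
      IsElation (reflection ε) z l := by
  have := charP_of_injective_algebraMap' (ZMod 2) (A := K) 2
  obtain ⟨η, hη, h⟩ := exists_eq_mul_star_of_norm_eq_one (mem_normOneUnits.1 hε)
  exact ⟨_, _, origin_mem_axis hη, mem_lineAtInfinity_iff.2 ⟨_, _, rfl⟩,
    isElation_reflection hη h⟩

/-- The elations that respect the nucleus, the line at infinity and the conics are the
reflections. -/
theorem isElation_and_forall_conic_iff (hq : 16 ≤ Nat.card K)
    (hp : (Module.finrank (ZMod 2) K).Prime) (hco : (Nat.card (semilinearGroup K)).Coprime 24)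
    {A : AddSubgroup K} (hA : Nat.card A = 4) {e : Equiv.Perm (PG2 K)} :
    ((∃ (l : Set (PG2 K)) (z : PG2 K), origin ∈ l ∧ z ∈ (lineAtInfinity : Set (PG2 K)) ∧
      IsElation e z l) ∧ ∀ c ∈ A, c ≠ 0 → e • conic 1 1 c = conic 1 1 c) ↔
      ∃ ε ∈ normOneUnits K, e = reflection ε := by
  have := charP_of_injective_algebraMap' (ZMod 2) (A := K) 2
  constructor
  · rintro ⟨⟨l, z, ho, hz, he⟩, hc⟩
    obtain ⟨ε, hε, rfl | rfl⟩ := (mem_autGroup_dennistonSet hq hp hco hA).1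
      (mem_autGroup_of_forall_conic he.mem_collineationGroup (he.fix_axis _ ho) hc)
    · exact absurd he (not_isElation_rotation ho)
    · exact ⟨ε, hε, rfl⟩
  · rintro ⟨ε, hε, rfl⟩
    exact ⟨exists_isElation_reflection hε, fun c _ _ => reflection_smul_conic hε c⟩

theorem existsUnique_reflection_isElation {l : Set (PG2 K)} (hl : IsLine l) (ho : origin ∈ l) :
    ∃! ε, ε ∈ normOneUnits K ∧ ∃ z ∈ (lineAtInfinity : Set (PG2 K)),
      IsElation (reflection ε) z l := by
  have := charP_of_injective_algebraMap' (ZMod 2) (A := K) 2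
  obtain ⟨η, hη, rfl⟩ := exists_eq_axis hl ho
  obtain ⟨ε, hε, h⟩ := exists_unit_of_mul_star_eq hη
  refine ⟨ε, ⟨hε, _, mem_lineAtInfinity_iff.2 ⟨_, _, rfl⟩, isElation_reflection hη h⟩, ?_⟩
  rintro ε' ⟨-, z, -, he⟩
  have h1 := he.fix_axis (affinePoint η) ((affinePoint_mem_axis hη).2 ⟨1, one_smul _ _⟩)
  rw [reflection_affinePoint] at h1
  exact Units.ext (mul_right_cancel₀ (star_ne_zero.2 hη)
    ((affinePoint_injective h1).trans h.symm))

end Automorphisms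

end PG2

/-! ### Arithmetic of a field of order `2 ^ (2 h + 1)` -/

section FieldOfOddPrimeDegree

variable {K : Type*} [Field K] [Finite K] [Algebra (ZMod 2) K]

theorem two_pow_odd_mod_three (h : ℕ) : 2 ^ (2 * h + 1) % 3 = 2 := by
  rw [pow_succ, pow_mul, Nat.mul_mod, Nat.pow_mod]
  norm_num

/-- A field of order `2 ^ (2 h + 1)` contains no primitive cube root of unity. -/
theorem sq_ne_one_add_self {h : ℕ} (hK : Nat.card K = 2 ^ (2 * h + 1)) (r : K) :
    r ^ 2 ≠ 1 + 1 * r := by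
  have := charP_of_injective_algebraMap' (ZMod 2) (A := K) 2
  intro hr
  have h2 : (2 : K) = 0 := CharTwo.two_eq_zero
  have h3 : r ^ 3 = 1 := by linear_combination (r + 1) * hr + r * h2
  have h1 : r ≠ 1 := by
    rintro rfl
    exact one_ne_zero (α := K) (by linear_combination hr + h2)
  have h0 : r ≠ 0 := by
    rintro rfl
    simp at h3
  have h4 := orderOf_eq_prime (x := Units.mk0 r h0) (p := 3) (by ext; simpa using h3)
    (fun h => h1 (by simpa using congrArg Units.val h))
  have h5 := orderOf_dvd_natCard (Units.mk0 r h0)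
  rw [h4, Nat.card_units, hK] at h5
  have h6 := two_pow_odd_mod_three h
  omega

theorem coprime_card_semilinearGroup {h : ℕ} (hprime : (2 * h + 1).Prime) (h3 : 2 * h + 1 ≠ 3)
    (hK : Nat.card K = 2 ^ (2 * h + 1)) (hfin : Module.finrank (ZMod 2) K = 2 * h + 1) :
    (Nat.card (semilinearGroup K)).Coprime 24 := by
  rw [card_semilinearGroup, hK, hfin, show 24 = 2 ^ 3 * 3 by norm_num]
  have h6 := two_pow_odd_mod_three h
  have h2 : 2 ^ (2 * h + 1) = 2 * 2 ^ (2 * h) := by rw [pow_succ, mul_comm]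
  have h7 : 0 < 2 ^ (2 * h) := by positivity
  refine Nat.Coprime.mul_left ?_ ?_
  · refine Nat.Coprime.mul_right (Nat.Coprime.pow_right _ ?_) ?_
    · rw [Nat.coprime_comm, Nat.prime_two.coprime_iff_not_dvd]
      omega
    · rw [Nat.coprime_comm, Nat.prime_three.coprime_iff_not_dvd]
      omega
  · refine Nat.Coprime.mul_right (Nat.Coprime.pow_right _ ?_) ?_
    · rw [Nat.coprime_comm, Nat.prime_two.coprime_iff_not_dvd]
      omega
    · exact (Nat.coprime_primes hprime Nat.prime_three).2 h3

end FieldOfOddPrimeDegree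

/-! ### Denniston arcs of degree four in odd prime degree -/

theorem mainTheorem5 (h : ℕ) (hprime : (2 * h + 1).Prime) (h3 : 2 * h + 1 ≠ 3)
    (K : Type*) [Field K] [Algebra (ZMod 2) K] (q : ℕ) (hq : q = 2 ^ (2 * h + 1))
    (hK : Nat.card K = q) :
    -- the number of isomorphism classes
    (Nat.card (DennistonClass K 4) : ℚ) = (2 ^ (2 * h) - 1) / (3 * (2 * h + 1)) ∧
    -- the automorphism group of each arc
    (∀ D : Set (PG2 K), IsDennistonArc 4 D →
      Nat.card (autGroup D) = 2 * (q + 1) ∧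
      ∃ φ : Multiplicative (ZMod 2) →* MulAut (Multiplicative (ZMod (q + 1))),
        Nonempty (autGroup D ≃* Multiplicative (ZMod (q + 1)) ⋊[φ] Multiplicative (ZMod 2))) ∧
    -- its action, in terms of the conics `g • conic α 1 c`, the nucleus `g origin` and
    -- the line at infinity `g • lineAtInfinity` of the arc
    ∀ (α : K) (A : AddSubgroup K) (g : Equiv.Perm (PG2 K)) (D : Set (PG2 K)),
      Algebra.trace (ZMod 2) K α = 1 → Nat.card A = 4 → g ∈ collineationGroup K →
      D = g • dennistonSet α A →
      (∃ C : Subgroup (Equiv.Perm (PG2 K)), C ≤ autGroup D ∧ IsCyclic C ∧ Nat.card C = q + 1 ∧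
        (∀ c ∈ A, c ≠ 0 →
          (∀ r ∈ C, r • (g • conic α 1 c) = g • conic α 1 c) ∧
          ∀ P ∈ g • conic α 1 c, ∀ Q ∈ g • conic α 1 c, ∃! r, r ∈ C ∧ r P = Q) ∧
        (∀ r ∈ C, r • (g • (lineAtInfinity : Set (PG2 K))) = g • lineAtInfinity) ∧
        ∀ P ∈ g • (lineAtInfinity : Set (PG2 K)), ∀ Q ∈ g • (lineAtInfinity : Set (PG2 K)),
          ∃! r, r ∈ C ∧ r P = Q) ∧
      {e : Equiv.Perm (PG2 K) | e ∈ autGroup D ∧ orderOf e = 2}.ncard = q + 1 ∧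
      (∀ e : Equiv.Perm (PG2 K), (e ∈ autGroup D ∧ orderOf e = 2) ↔
        (∃ (l : Set (PG2 K)) (z : PG2 K), g origin ∈ l ∧ z ∈ g • lineAtInfinity ∧
          IsElation e z l) ∧
        ∀ c ∈ A, c ≠ 0 → e • (g • conic α 1 c) = g • conic α 1 c) ∧
      ∀ l : Set (PG2 K), IsLine l → g origin ∈ l →
        ∃! e : Equiv.Perm (PG2 K), (e ∈ autGroup D ∧ orderOf e = 2) ∧
          ∃ z ∈ g • lineAtInfinity, IsElation e z l := by
  subst hq
  have hfinite : Finite K := Nat.finite_of_card_ne_zero (by rw [hK]; positivity)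
  have : CharP K 2 := charP_of_injective_algebraMap' (ZMod 2) (A := K) 2
  have : Fact (∀ r : K, r ^ 2 ≠ 1 + 1 * r) := ⟨sq_ne_one_add_self hK⟩
  have hfin : Module.finrank (ZMod 2) K = 2 * h + 1 := by
    have h1 := Module.natCard_eq_pow_finrank (K := ZMod 2) (V := K)
    rw [hK, Nat.card_zmod] at h1
    exact (Nat.pow_right_injective le_rfl h1).symm
  have hp : (Module.finrank (ZMod 2) K).Prime := hfin ▸ hprime
  have hodd : Odd (Module.finrank (ZMod 2) K) := hfin ▸ ⟨h, rfl⟩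
  have hco := coprime_card_semilinearGroup hprime h3 hK hfin
  have h2 : 2 ≤ h := by
    have := hprime.two_le
    omega
  have hq : 16 ≤ Nat.card K := by
    rw [hK]
    calc 16 = 2 ^ 4 := by norm_num
      _ ≤ 2 ^ (2 * h + 1) := Nat.pow_le_pow_right (by norm_num) (by omega)
  rw [← hK]
  refine ⟨?_, ?_, ?_⟩
  · rw [card_dennistonClass hq hodd]
    have h1 := card_orbits hp hco
    rw [hfin, hK, pow_succ] at h1
    generalize Nat.card (MulAction.orbitRel.Quotient (semilinearGroup K)
      {A : AddSubgroup K // Nat.card A = 4}) = n at h1 ⊢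
    have h4 : 0 < 2 ^ (2 * h) := by positivity
    have h5 : n * (2 * h + 1) * 6 + 2 = 2 ^ (2 * h) * 2 := by omega
    have h6 : (n : ℚ) * (2 * h + 1) * 6 + 2 = 2 ^ (2 * h) * 2 := by exact_mod_cast h5
    rw [eq_div_iff (by positivity)]
    linear_combination h6 / 2
  · intro D hD
    obtain ⟨A, hA, g, hg, rfl⟩ := exists_smul_eq_dennistonSet hodd hD
    rw [autGroup_smul hg]
    have e := (autGroup (dennistonSet 1 A)).equivMapOfInjective (MulAut.conj g).toMonoidHom
      (MulAut.conj g).injective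
    obtain ⟨φ, ⟨e'⟩⟩ := exists_autGroup_mulEquiv hq hp hco hA
    exact ⟨(Nat.card_congr e.toEquiv).symm.trans (card_autGroup_dennistonSet hq hp hco hA),
      φ, ⟨e.symm.trans e'⟩⟩
  · rintro α A g₀ D hα hA hg₀ rfl
    -- Absorbing the shear that normalises the pencil into the collineation reduces to `α = 1`.
    obtain ⟨s, hs, hso, hsL, hsc⟩ := exists_pencil_equiv hodd hα
    obtain ⟨g, hg, hgo, hgL, hgc, hgD⟩ : ∃ g ∈ collineationGroup K, g₀ origin = g origin ∧
        g₀ • (lineAtInfinity : Set (PG2 K)) = g • lineAtInfinity ∧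
        (∀ c, g₀ • conic α 1 c = g • conic 1 1 c) ∧
        g₀ • dennistonSet α A = g • dennistonSet 1 A := by
      refine ⟨g₀ * s, mul_mem hg₀ hs, ?_, ?_, fun c => ?_, ?_⟩
      · rw [Equiv.Perm.mul_apply, hso]
      · rw [mul_smul, hsL]
      · rw [mul_smul, hsc]
      · rw [mul_smul, smul_dennistonSet hso fun c _ _ => hsc c]
    rw [hgD, hgo, hgL, autGroup_smul hg]
    simp only [hgc]
    have hconj : ∀ (e : Equiv.Perm (PG2 K)) (S : Set (PG2 K)),
        (g * e * g⁻¹) • g • S = g • S ↔ e • S = S := fun e S => by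
      rw [mul_smul, inv_smul_smul, mul_smul, smul_left_cancel_iff]
    have hsharp : ∀ S : Set (PG2 K), (∀ P ∈ S, ∀ Q ∈ S, ∃! ε, ε ∈ normOneUnits K ∧
        rotation ε P = Q) → ∀ P ∈ g • S, ∀ Q ∈ g • S,
        ∃! r, r ∈ (normOneUnits K).map ((MulAut.conj g).toMonoidHom.comp rotation) ∧ r P = Q := by
      rintro S hS _ ⟨P, hP, rfl⟩ _ ⟨Q, hQ, rfl⟩
      obtain ⟨ε, ⟨hε, h1⟩, h4⟩ := hS P hP Q hQ
      refine ⟨g * rotation ε * g⁻¹, ⟨⟨ε, hε, rfl⟩, by simp [h1]⟩, ?_⟩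
      rintro _ ⟨⟨ε', hε', rfl⟩, h5⟩
      have h6 : rotation ε' P = Q := by simpa using h5
      rw [← h4 ε' ⟨hε', h6⟩]
      rfl
    have hinv : ∀ e : Equiv.Perm (PG2 K),
        (e ∈ (autGroup (dennistonSet 1 A)).map (MulAut.conj g).toMonoidHom ∧ orderOf e = 2) ↔
          ∃ ε ∈ normOneUnits K, e = g * reflection ε * g⁻¹ := by
      intro e
      obtain ⟨e, rfl⟩ := (MulAut.conj g).surjective e
      rw [MulEquiv.orderOf_eq, Subgroup.mem_map_equiv, MulEquiv.symm_apply_apply,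
        mem_autGroup_and_orderOf_eq_two_iff hq hp hco hA]
      simp only [← MulAut.conj_apply, EmbeddingLike.apply_eq_iff_eq]
    refine ⟨⟨(normOneUnits K).map ((MulAut.conj g).toMonoidHom.comp rotation),
      ?_, ?_, ?_, ?_, ?_, ?_⟩, ?_, ?_, ?_⟩
    · rw [← Subgroup.map_map]
      refine Subgroup.map_mono ?_
      rintro _ ⟨ε, hε, rfl⟩
      exact (mem_autGroup_dennistonSet hq hp hco hA).2 ⟨ε, hε, Or.inl rfl⟩
    · exact isCyclic_map_normOneUnits ((MulAut.conj g).injective.comp rotation_injective)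
    · exact card_map_normOneUnits ((MulAut.conj g).injective.comp rotation_injective)
    · intro c _ hc0
      refine ⟨?_, hsharp _ fun P hP Q hQ => existsUnique_rotation_conic hc0 hP hQ⟩
      rintro _ ⟨ε, hε, rfl⟩
      exact (hconj _ _).2 (rotation_smul_conic hε c)
    · rintro _ ⟨ε, hε, rfl⟩
      exact (hconj _ _).2 (rotation_smul_lineAtInfinity ε)
    · exact hsharp _ fun P hP Q hQ => existsUnique_rotation_lineAtInfinity hP hQ
    · have h1 : {e : Equiv.Perm (PG2 K) |
          e ∈ (autGroup (dennistonSet 1 A)).map (MulAut.conj g).toMonoidHom ∧ orderOf e = 2} =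
          (fun ε => MulAut.conj g (reflection ε)) '' normOneUnits K := by
        ext e
        refine (hinv e).trans ⟨?_, ?_⟩
        · rintro ⟨ε, hε, rfl⟩
          exact ⟨ε, hε, rfl⟩
        · rintro ⟨ε, hε, rfl⟩
          exact ⟨ε, hε, rfl⟩
      rw [h1]
      exact (Set.ncard_image_of_injective _
        ((MulAut.conj g).injective.comp reflection_injective)).trans
        ((Nat.card_coe_set_eq _).symm.trans card_normOneUnits)
    · intro e
      rw [hinv]
      obtain ⟨e, rfl⟩ := (MulAut.conj g).surjective e
      simp only [← MulAut.conj_apply, EmbeddingLike.apply_eq_iff_eq]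
      rw [← isElation_and_forall_conic_iff hq hp hco hA]
      simp only [MulAut.conj_apply, hconj]
      refine and_congr_left fun _ => ⟨?_, ?_⟩
      · rintro ⟨l, z, ho, hz, he⟩
        exact ⟨g • l, g z, Set.smul_mem_smul_set ho, Set.smul_mem_smul_set hz, he.conj hg⟩
      · rintro ⟨l, _, ho, ⟨z, hz, rfl⟩, he⟩
        refine ⟨g⁻¹ • l, z, Set.mem_inv_smul_set_iff.2 ho, hz, (isElation_conj_iff hg).1 ?_⟩
        rwa [smul_inv_smul]
    · intro l hl ho
      obtain ⟨l, rfl⟩ : ∃ l', l = g • l' := ⟨g⁻¹ • l, (smul_inv_smul _ _).symm⟩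
      obtain ⟨ε, ⟨hε, z, hz, he⟩, hu⟩ := existsUnique_reflection_isElation
        ((isLine_smul_iff hg).1 hl) (Set.smul_mem_smul_set_iff.1 ho)
      refine ⟨g * reflection ε * g⁻¹, ⟨(hinv _).2 ⟨ε, hε, rfl⟩, g z,
        Set.smul_mem_smul_set hz, he.conj hg⟩, ?_⟩
      rintro _ ⟨h1, _, ⟨z', hz', rfl⟩, he'⟩
      obtain ⟨ε', hε', rfl⟩ := (hinv _).1 h1
      rw [hu ε' ⟨hε', z', hz', (isElation_conj_iff hg).1 he'⟩]
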